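/- **Theorem (lower bound for weakly log-concave samplers).** For a potential $f:\mathbb R^d\to\mathbb R$ with $\int e^{-f}<\infty$ let $\pi_f$ be the probability distribution with density proportional to $e^{-f}$. Call $f$ *$1$-smooth* if it is twice differentiable with $\nabla^2 f\preceq I$. A probability distribution $\rho_0$ is an *$M$-infinite Rényi warm start* for $\pi$ if $\mathcal R_\infty(\rho_0\|\pi)=\ln\big\|\tfrac{d\rho_0}{d\pi}\big\|_{L^\infty(\pi)}\le M$ (with value $+\infty$ unless $\rho_0\ll\pi$). A *randomized adaptive algorithm* $\mathsf A$ with $k$ queries per round receives a random initial point $x^0\sim\rho_0$, with the value $f(x^0)$, and a number of rounds $r$. In each round $i=1,\dots,r$ it chooses a batch of at most $k$ points as a measurable function of a fresh random variable, uniform on $[0,1]$, and of all previous points and answers, and it receives the values of $f$ at these points. After round $r$ it returns a point $x^{r+1}$, again a measurable function of a fresh uniform random variable and of all points and answers so far. Let $\mathsf T(\mathsf A,f,x^0,\varepsilon)\in\{0,1,2,\dots\}\cup\{\infty\}$ be the least $r$ for which the law $\rho$ of the returned point satisfies $\mathsf{TV}(\rho,\pi_f)=\sup_A|\rho(A)-\pi_f(A)|\le\varepsilon$.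 For a class $\mathcal F$ of potentials on $\mathbb R^d$ put $$\mathsf{Comp}^{k}_{\mathsf R}(\mathcal F,\varepsilon,x^0)=\inf_{\mathsf A}\ \sup_{f\in\mathcal F}\ \mathsf T(\mathsf A,f,x^0,\varepsilon),$$ the infimum being over all randomized adaptive algorithms with $k$ queries per round. Let the regularity condition be either "$1$-smooth" or "$1$-Lipschitz". For a probability distribution $\rho_0$ on $\mathbb R^d$ and $M\in\mathbb R$, let $\mathcal F_d(\rho_0,M)$ be the class of all convex potentials $f$ on $\mathbb R^d$ (no strong convexity) that satisfy the regularity condition, for which $\int e^{-f}<\infty$, and for which $\rho_0$ is an $M$-infinite Rényi warm start for $\pi_f$. Then, for each of the two conditions, there are constants $c\in(0,1)$, $C\in\mathbb R$ and $m\in\mathbb N$ such that for all $\alpha=\alpha(d)\to\infty$ and all $\varepsilon=\varepsilon(d)=O(c^d)$ there are $\gamma=\gamma(d)=O(d^{-\alpha(d)})$ and probability distributions $\rho_0=\rho_{0,d}$ on $\mathbb R^d$ with the following property. Let $M_d=C\,d\,(\log d)^m=\widetilde O(d)$. For every polynomial $q$ with natural number coefficients, and all $d$ sufficiently large (depending on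 $q,\alpha,\varepsilon$), $$\mathsf{Comp}^{q(d)}_{\mathsf R}\big(\mathcal F_d(\rho_0,M_d),\varepsilon,x^0\big)\ \ge\ (1-\gamma)\,\frac{d}{\alpha\log^3 d},\qquad x^0\sim\rho_0 .$$ -/

import Mathlib

open MeasureTheory Filter Asymptotics
open scoped ENNReal

/-- Euclidean space of dimension `d`. -/
abbrev Eucl (d : ℕ) : Type := EuclideanSpace ℝ (Fin d)

noncomputable section

/-- The distribution `π_f` with Lebesgue density `exp (-f) / ∫ exp (-f)`. -/
def gibbs {d : ℕ} (f : Eucl d → ℝ) : Measure (Eucl d) :=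
  (volume : Measure (Eucl d)).tilted (fun x => -f x)

/-- Total variation distance: the supremum over measurable sets `A` of `|μ A - ν A|`. -/
def tvDist {X : Type*} [MeasurableSpace X] (μ ν : Measure X) : ℝ :=
  ⨆ A : {A : Set X // MeasurableSet A}, |μ.real A.1 - ν.real A.1|

open scoped Classical in
/-- Infinite Rényi divergence `log ‖dμ/dν‖_{L^∞(ν)}`, equal to `+∞` unless `μ ≪ ν`. -/
def renyiInf {X : Type*} [MeasurableSpace X] (μ ν : Measure X) : EReal :=
  if μ ≪ ν then ENNReal.log (essSup (μ.rnDeriv ν) ν) else ⊤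

/-- The two regularity conditions on a convex potential. -/
inductive Regularity
  | smooth
  | lipschitz

/-- `f` is twice differentiable with Hessian at most `L • I` in the Loewner order. -/
def IsSmoothPotential {d : ℕ} (L : ℝ) (f : Eucl d → ℝ) : Prop :=
  Differentiable ℝ f ∧ Differentiable ℝ (fderiv ℝ f) ∧
    ∀ x v : Eucl d, fderiv ℝ (fderiv ℝ f) x v v ≤ L * ‖v‖ ^ 2

/-- Convex potentials on `ℝ^d` that are `1`-smooth, respectively `1`-Lipschitz. -/
def convexPotentials (reg : Regularity) (d : ℕ) : Set (Eucl d → ℝ) :=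
  {f | ConvexOn ℝ Set.univ f ∧
    match reg with
    | .smooth => IsSmoothPotential 1 f
    | .lipschitz => LipschitzWith 1 f}

/-- The potentials of the given regularity for which `π_f` is a probability distribution and `ρ₀`
is an `M`-infinite Rényi warm start for `π_f`. -/
def warmPotentials (reg : Regularity) (d : ℕ) (ρ₀ : Measure (Eucl d)) (M : ℝ) :
    Set (Eucl d → ℝ) :=
  {f | f ∈ convexPotentials reg d ∧ Integrable (fun x => Real.exp (-f x)) ∧
    renyiInf ρ₀ (gibbs f) ≤ (M : EReal)}

/-- What an algorithm has seen after `n` rounds with `k` queries each: the initial point with the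
oracle's answer, and for each round the batch of queries with the oracle's answers. -/
abbrev Transcript (d k n : ℕ) : Type :=
  (Eucl d × ℝ) × (Fin n → Fin k → Eucl d × ℝ)

/-- A randomized adaptive algorithm in dimension `d` with (at most) `k` queries per round.
Given the number `r` of rounds, `next r i` chooses the batch queried in round `i + 1` (`i < r`) and
`output r` chooses the returned point, each from fresh random bits (a uniform element of `[0, 1]`)
and the transcript so far. Smaller batches are covered by repeating a query. -/
structure AdaptiveAlgorithm (d k : ℕ) where
  next : (r i : ℕ) → unitInterval × Transcript d k i → (Fin k → Eucl d)
  output : (r : ℕ) → unitInterval × Transcript d k r → Eucl d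
  measurable_next : ∀ r i, Measurable (next r i)
  measurable_output : ∀ r, Measurable (output r)

namespace AdaptiveAlgorithm

variable {d k : ℕ}

/-- The transcript after `n` rounds of the run with `r` rounds in total, for the zeroth-order oracle
of `f`, the initial point `x₀` and the random bits `ξ`. -/
def transcript (A : AdaptiveAlgorithm d k) (f : Eucl d → ℝ) (r : ℕ) (x₀ : Eucl d)
    (ξ : ℕ → unitInterval) : (n : ℕ) → Transcript d k n
  | 0 => ((x₀, f x₀), Fin.elim0)
  | n + 1 =>
    let h := A.transcript f r x₀ ξ n
    let Q := A.next r n (ξ n, h)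
    (h.1, Fin.snoc (α := fun _ => Fin k → Eucl d × ℝ) h.2 (fun j => (Q j, f (Q j))))

/-- The point returned after `r` rounds. -/
def run (A : AdaptiveAlgorithm d k) (f : Eucl d → ℝ) (r : ℕ) (x₀ : Eucl d)
    (ξ : ℕ → unitInterval) : Eucl d :=
  A.output r (ξ r, A.transcript f r x₀ ξ r)

/-- The marginal law of the point returned after `r` rounds, for an initial point distributed
according to `ρ₀` and independent, independently and uniformly distributed random bits. -/
def outputLaw (A : AdaptiveAlgorithm d k) (f : Eucl d → ℝ) (ρ₀ : Measure (Eucl d)) (r : ℕ) :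
    Measure (Eucl d) :=
  (ρ₀.prod (Measure.infinitePi fun _ : ℕ => (volume : Measure unitInterval))).map
    fun ω => A.run f r ω.1 ω.2

/-- The least number of rounds after which the output is `ε`-accurate in total variation
(`⊤` if there is none). -/
def rounds (A : AdaptiveAlgorithm d k) (f : Eucl d → ℝ) (ρ₀ : Measure (Eucl d)) (ε : ℝ) : ℕ∞ :=
  ⨅ r ∈ {r : ℕ | tvDist (A.outputLaw f ρ₀ r) (gibbs f) ≤ ε}, (r : ℕ∞)

end AdaptiveAlgorithm

/-- Randomized adaptive complexity of the class `F` with `k` queries per round. -/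
def randomizedComplexity {d : ℕ} (k : ℕ) (F : Set (Eucl d → ℝ)) (ε : ℝ) (ρ₀ : Measure (Eucl d)) :
    ℕ∞ :=
  ⨅ A : AdaptiveAlgorithm d k, ⨆ f ∈ F, A.rounds f ρ₀ ε

end

noncomputable section

/-! The proof hides a direction in a coordinate plane. Its slope is given by `d` base-`B` digits,
with `B = d ^ Nat.log 2 d` larger than every polynomial in `d`. The hard potential `needle` is, in
that plane, a soft maximum of wedges around nested cones: cone `j` surrounds the direction given by
the first `j` digits and has width of order `B⁻ʲ`. Outside cone `j` the wedge `j` dominates all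
later ones by more than the smoothing scale. The soft maximum is then exactly a function of the
first `j` digits (`wedgeChain_congr_of_not_inCone`), so a query there reveals nothing about the
later digits.

A fixed point lies in cone `j + 1` for at most 11 values of the newest digit
(`card_inCone_update_le`). Hence a round of `k` queries that knows `j` digits hits the next cone
with probability at most `11 k / B` over a random digit. Up to such lucky events each round uncovers
one digit, and with fewer than `d - 1` rounds the output misses the last cone with high probability.
Averaging over the digits (`exists_sum_le_of_sum_update_le`) gives one potential that defeats a
given algorithm for all these numbers of rounds at once (`exists_outputLaw_le`).

The Gibbs measure, however, puts at least half of its mass on the last cone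
(`half_le_gibbs_needle`). The potential stays bounded along the hidden ray up to length of order `K
= B ^ (6 * d)`, while the mass off the cone is bounded independently of `K`. The total variation
error is therefore at least `1/2 - 1/8`. The normalizing constant is at most polynomial in `K` up to
factors no larger than powers of `B ^ d`. The uniform law on the unit ball is thus a warm start with
`M` of order `d log B`, which is of order `d log² d` (`renyiInf_needle_le`).

The same potentials are both 1-smooth and 1-Lipschitz, so one construction serves both regularity
conditions. -/

/-! ### Twice differentiable positive part, maximum and absolute value. -/

theorem hasDerivAt_max_zero_pow (n : ℕ) (t : ℝ) :
    HasDerivAt (fun t : ℝ => max t 0 ^ (n + 2)) ((n + 2 : ℝ) * max t 0 ^ (n + 1)) t := by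
  rcases lt_trichotomy t 0 with h | h | h
  · have : (fun t : ℝ => max t 0 ^ (n + 2)) =ᶠ[nhds t] fun _ => 0 := by
      filter_upwards [Iio_mem_nhds h] with y hy
      rw [max_eq_right (le_of_lt hy)]; simp
    rw [max_eq_right h.le]
    simpa using (hasDerivAt_const t (0 : ℝ)).congr_of_eventuallyEq this
  · subst h
    have h2 : HasDerivAt (fun t : ℝ => max t 0 ^ (n + 2)) 0 0 := by
      rw [hasDerivAt_iff_isLittleO_nhds_zero]
      have hb : (fun h : ℝ => max (0 + h) 0 ^ (n + 2) - max (0 : ℝ) 0 ^ (n + 2) - h • (0 : ℝ))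
          =O[nhds 0] fun h : ℝ => h ^ (n + 2) := by
        refine IsBigO.of_bound 1 (Eventually.of_forall fun h => ?_)
        simp only [zero_add, max_self, ne_eq, Nat.add_eq_zero_iff, OfNat.ofNat_ne_zero, and_false,
          not_false_eq_true, zero_pow, sub_zero, smul_zero, norm_pow, one_mul]
        refine pow_le_pow_left₀ (norm_nonneg _) ?_ _
        rw [Real.norm_eq_abs, Real.norm_eq_abs, abs_of_nonneg (le_max_right _ _)]
        exact max_le (le_abs_self h) (abs_nonneg h)
      refine hb.trans_isLittleO ?_
      have := isLittleO_pow_id (𝕜 := ℝ) (n := n + 2) (by omega)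
      simpa using this
    simpa using h2
  · have : (fun t : ℝ => max t 0 ^ (n + 2)) =ᶠ[nhds t] fun t => t ^ (n + 2) := by
      filter_upwards [Ioi_mem_nhds h] with y hy
      rw [max_eq_left (le_of_lt hy)]
    rw [max_eq_left h.le]
    have h3 := (hasDerivAt_pow (n + 2) t).congr_of_eventuallyEq this
    simpa using h3

/-- A twice differentiable convex modification of the positive part, equal to it outside
`[-1, 1]`. -/
def softPos (t : ℝ) : ℝ := (max (t + 1) 0 ^ 3 - 2 * max t 0 ^ 3 + max (t - 1) 0 ^ 3) / 6

/-- The derivative of `softPos`. -/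
def softPosD (t : ℝ) : ℝ := (max (t + 1) 0 ^ 2 - 2 * max t 0 ^ 2 + max (t - 1) 0 ^ 2) / 2

/-- The second derivative of `softPos`. -/
def softPosDD (t : ℝ) : ℝ := max (t + 1) 0 - 2 * max t 0 + max (t - 1) 0

theorem hasDerivAt_softPos (t : ℝ) : HasDerivAt softPos (softPosD t) t := by
  have h0 := hasDerivAt_max_zero_pow 1 t
  have h1 := (hasDerivAt_max_zero_pow 1 (t + 1)).comp_add_const t 1
  have h2 := (hasDerivAt_max_zero_pow 1 (t - 1)).comp_sub_const t 1
  have := ((h1.sub (h0.const_mul 2)).add h2).div_const 6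
  refine this.congr_deriv ?_
  simp only [softPosD]; push_cast; ring

theorem hasDerivAt_softPosD (t : ℝ) : HasDerivAt softPosD (softPosDD t) t := by
  have h0 := hasDerivAt_max_zero_pow 0 t
  have h1 := (hasDerivAt_max_zero_pow 0 (t + 1)).comp_add_const t 1
  have h2 := (hasDerivAt_max_zero_pow 0 (t - 1)).comp_sub_const t 1
  have := ((h1.sub (h0.const_mul 2)).add h2).div_const 2
  refine this.congr_deriv ?_
  simp only [softPosDD]; push_cast; ring

theorem softPosDD_nonneg (t : ℝ) : 0 ≤ softPosDD t := by
  unfold softPosDD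
  rcases max_cases (t + 1) 0 with h | h <;> rcases max_cases t 0 with h' | h' <;>
    rcases max_cases (t - 1) 0 with h'' | h'' <;> linarith

theorem softPosDD_le_one (t : ℝ) : softPosDD t ≤ 1 := by
  unfold softPosDD
  rcases max_cases (t + 1) 0 with h | h <;> rcases max_cases t 0 with h' | h' <;>
    rcases max_cases (t - 1) 0 with h'' | h'' <;> linarith

theorem softPos_of_one_le {t : ℝ} (h : 1 ≤ t) : softPos t = t := by
  unfold softPos
  rw [max_eq_left (by linarith), max_eq_left (by linarith), max_eq_left (by linarith)]; ring

theorem monotone_softPosD : Monotone softPosD :=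
  monotone_of_deriv_nonneg (fun t => (hasDerivAt_softPosD t).differentiableAt)
    fun t => by rw [(hasDerivAt_softPosD t).deriv]; exact softPosDD_nonneg t

theorem softPosD_nonneg (t : ℝ) : 0 ≤ softPosD t := by
  have h : softPosD (min t (-1)) = 0 := by
    have := min_le_right t (-1)
    generalize min t (-1) = y at this
    unfold softPosD
    rw [max_eq_right (by linarith), max_eq_right (by linarith), max_eq_right (by linarith)]
    norm_num
  exact h ▸ monotone_softPosD (min_le_left t (-1))

theorem softPosD_le_one (t : ℝ) : softPosD t ≤ 1 := by
  have h : softPosD (max t 1) = 1 := by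
    have := le_max_right t 1
    generalize max t 1 = y at this
    unfold softPosD
    rw [max_eq_left (by linarith), max_eq_left (by linarith), max_eq_left (by linarith)]
    ring
  exact h ▸ monotone_softPosD (le_max_left t 1)

theorem monotone_softPos : Monotone softPos :=
  monotone_of_deriv_nonneg (fun t => (hasDerivAt_softPos t).differentiableAt)
    fun t => by rw [(hasDerivAt_softPos t).deriv]; exact softPosD_nonneg t

/-- Since `softMax a b = a - ((a - b) - softPos (a - b))`, this is what makes `softMax` monotone in
its second argument. -/
theorem monotone_sub_softPos : Monotone fun t => t - softPos t :=
  monotone_of_deriv_nonneg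
    (fun t => ((hasDerivAt_id t).sub (hasDerivAt_softPos t)).differentiableAt)
    fun t => by
      change 0 ≤ deriv (id - softPos) t
      rw [((hasDerivAt_id t).sub (hasDerivAt_softPos t)).deriv]
      linarith [softPosD_le_one t]

theorem convexOn_softPos : ConvexOn ℝ Set.univ softPos := by
  refine Monotone.convexOn_univ_of_deriv
    (fun t => (hasDerivAt_softPos t).differentiableAt) ?_
  have : deriv softPos = softPosD := funext fun t => (hasDerivAt_softPos t).deriv
  rw [this]; exact monotone_softPosD

theorem softPos_nonneg (t : ℝ) : 0 ≤ softPos t := by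
  have h : softPos (min t (-1)) = 0 := by
    have := min_le_right t (-1)
    generalize min t (-1) = y at this
    unfold softPos
    rw [max_eq_right (by linarith), max_eq_right (by linarith), max_eq_right (by linarith)]
    norm_num
  exact h ▸ monotone_softPos (min_le_left t (-1))

theorem self_le_softPos (t : ℝ) : t ≤ softPos t := by
  have := monotone_sub_softPos (le_max_left t 1)
  simp only [softPos_of_one_le (le_max_right t 1)] at this
  linarith

theorem softPos_zero : softPos 0 = 1 / 6 := by unfold softPos; norm_num

theorem softPos_le (t : ℝ) : softPos t ≤ max t 0 + 1 / 6 := by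
  rcases le_total t 0 with h | h
  · rw [max_eq_right h]; linarith [monotone_softPos h, softPos_zero]
  · rw [max_eq_left h]
    have := monotone_sub_softPos h
    simp only [softPos_zero] at this
    linarith

/-- A twice differentiable convex modification of the maximum of two numbers. -/
def softMax (a b : ℝ) : ℝ := b + softPos (a - b)

theorem le_softMax_right (a b : ℝ) : b ≤ softMax a b := by
  unfold softMax; linarith [softPos_nonneg (a - b)]

theorem softMax_le {a b c : ℝ} (ha : a ≤ c) (hb : b ≤ c) : softMax a b ≤ c + 1 / 6 := by
  unfold softMax
  have := softPos_le (a - b)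
  rcases max_cases (a - b) 0 with h | h <;> linarith

theorem softMax_of_add_one_le {a b : ℝ} (h : b + 1 ≤ a) : softMax a b = a := by
  unfold softMax; rw [softPos_of_one_le (by linarith)]; ring

theorem softMax_mono {a a' b b' : ℝ} (ha : a ≤ a') (hb : b ≤ b') :
    softMax a b ≤ softMax a' b' := by
  unfold softMax
  have h1 := monotone_softPos (sub_le_sub_right ha b)
  have h2 := monotone_sub_softPos (sub_le_sub_left hb a')
  simp only at h2
  linarith

/-- A twice differentiable convex modification of the absolute value. -/
def softAbs (t : ℝ) : ℝ := softPos t + softPos (-t)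

theorem abs_le_softAbs (t : ℝ) : |t| ≤ softAbs t := by
  unfold softAbs
  rcases abs_cases t with h | h
  · linarith [self_le_softPos t, softPos_nonneg (-t)]
  · linarith [self_le_softPos (-t), softPos_nonneg t]

theorem softAbs_le (t : ℝ) : softAbs t ≤ |t| + 1 / 3 := by
  unfold softAbs
  have h1 := softPos_le t
  have h2 := softPos_le (-t)
  rcases le_total t 0 with h | h
  · rw [max_eq_right h] at h1; rw [max_eq_left (by linarith)] at h2; rw [abs_of_nonpos h]; linarith
  · rw [max_eq_left h] at h1; rw [max_eq_right (by linarith)] at h2; rw [abs_of_nonneg h]; linarith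

/-! ### Calculus of convex functions with gradient and Hessian bounds. -/

/-- `g` is convex and twice differentiable, its gradient has norm at most `L` and its Hessian is
at most `H • I`. -/
structure SmoothConvex {V : Type*} [NormedAddCommGroup V] [NormedSpace ℝ V] (L H : ℝ)
    (g : V → ℝ) : Prop where
  convex : ConvexOn ℝ Set.univ g
  diff : Differentiable ℝ g
  diff_fderiv : Differentiable ℝ (fderiv ℝ g)
  norm_fderiv_le : ∀ x, ‖fderiv ℝ g x‖ ≤ L
  hessian_le : ∀ x v, fderiv ℝ (fderiv ℝ g) x v v ≤ H * ‖v‖ ^ 2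

namespace SmoothConvex

variable {V : Type*} [NormedAddCommGroup V] [NormedSpace ℝ V] {L H L' H' : ℝ} {g g' : V → ℝ}

theorem mono (h : SmoothConvex L H g) (hL : L ≤ L') (hH : H ≤ H') : SmoothConvex L' H' g :=
  ⟨h.convex, h.diff, h.diff_fderiv, fun x => (h.norm_fderiv_le x).trans hL, fun x v =>
    (h.hessian_le x v).trans (mul_le_mul_of_nonneg_right hH (sq_nonneg _))⟩

theorem add (h : SmoothConvex L H g) (h' : SmoothConvex L' H' g') :
    SmoothConvex (L + L') (H + H') (fun x => g x + g' x) := by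
  have e : fderiv ℝ (fun x => g x + g' x) = fun x => fderiv ℝ g x + fderiv ℝ g' x :=
    funext fun x => fderiv_fun_add (h.diff x) (h'.diff x)
  refine ⟨h.convex.add h'.convex, h.diff.add h'.diff, ?_, fun x => ?_, fun x v => ?_⟩
  · rw [e]; exact h.diff_fderiv.add h'.diff_fderiv
  · rw [e]; exact (norm_add_le _ _).trans (add_le_add (h.norm_fderiv_le x) (h'.norm_fderiv_le x))
  · rw [e, fderiv_fun_add (h.diff_fderiv x) (h'.diff_fderiv x), add_mul]
    exact add_le_add (h.hessian_le x v) (h'.hessian_le x v)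

theorem const_mul (h : SmoothConvex L H g) {w : ℝ} (hw : 0 ≤ w) :
    SmoothConvex (w * L) (w * H) (fun x => w * g x) := by
  have e : fderiv ℝ (fun x => w * g x) = fun x => w • fderiv ℝ g x :=
    funext fun x => fderiv_const_mul (h.diff x) w
  refine ⟨h.convex.smul hw, h.diff.const_mul w, ?_, fun x => ?_, fun x v => ?_⟩
  · rw [e]; exact h.diff_fderiv.const_smul w
  · rw [e, norm_smul, Real.norm_eq_abs, abs_of_nonneg hw]
    exact mul_le_mul_of_nonneg_left (h.norm_fderiv_le x) hw
  · rw [e, fderiv_fun_const_smul (h.diff_fderiv x), mul_assoc]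
    exact mul_le_mul_of_nonneg_left (h.hessian_le x v) hw

theorem affine (ℓ : V →L[ℝ] ℝ) (b : ℝ) : SmoothConvex ‖ℓ‖ 0 (fun x => ℓ x + b) := by
  have e : fderiv ℝ (fun x => ℓ x + b) = fun _ => ℓ := funext fun x => by
    rw [fderiv_add_const]; exact ℓ.fderiv
  refine ⟨?_, ℓ.differentiable.add_const b, ?_, fun x => ?_, fun x v => ?_⟩
  · exact (ℓ.toLinearMap.convexOn convex_univ).add_const b
  · rw [e]; exact differentiable_const _
  · rw [e]
  · rw [e]; simp

theorem sum {ι : Type*} (s : Finset ι) {g : ι → V → ℝ} {L H : ι → ℝ}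
    (h : ∀ i ∈ s, SmoothConvex (L i) (H i) (g i)) :
    SmoothConvex (∑ i ∈ s, L i) (∑ i ∈ s, H i) (fun x => ∑ i ∈ s, g i x) := by
  classical
  induction s using Finset.induction_on with
  | empty => simpa using affine (0 : V →L[ℝ] ℝ) 0
  | insert i s hi ih =>
    simp only [Finset.sum_insert hi]
    exact (h i (Finset.mem_insert_self i s)).add
      (ih fun j hj => h j (Finset.mem_insert_of_mem hj))

end SmoothConvex

section composition

variable {V : Type*} [NormedAddCommGroup V] [NormedSpace ℝ V] {u : V → ℝ}

theorem fderiv_softPos_comp (hu : Differentiable ℝ u) :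
    fderiv ℝ (fun x => softPos (u x)) = fun x => softPosD (u x) • fderiv ℝ u x :=
  funext fun x => ((hasDerivAt_softPos (u x)).comp_hasFDerivAt x (hu x).hasFDerivAt).fderiv

theorem hasFDerivAt_fderiv_softPos_comp (hu : Differentiable ℝ u)
    (hu' : Differentiable ℝ (fderiv ℝ u)) (x : V) :
    HasFDerivAt (fderiv ℝ (fun x => softPos (u x)))
      (softPosD (u x) • fderiv ℝ (fderiv ℝ u) x +
        (softPosDD (u x) • fderiv ℝ u x).smulRight (fderiv ℝ u x)) x := by
  rw [fderiv_softPos_comp hu]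
  exact ((hasDerivAt_softPosD (u x)).comp_hasFDerivAt x (hu x).hasFDerivAt).fun_smul
    (hu' x).hasFDerivAt

end composition

namespace SmoothConvex

variable {V : Type*} [NormedAddCommGroup V] [NormedSpace ℝ V] {L H L' H' : ℝ} {g g' : V → ℝ}

/-- The gradient of a soft maximum is a convex combination of the two gradients, so `L` does not
grow under iteration. The Hessian is the same combination plus a rank-one term, `softPosDD` times
the square of the gradient difference. Each soft maximum therefore costs only an additive `(2 * L) ^
2`. -/
theorem softMax (h : SmoothConvex L H g) (h' : SmoothConvex L H g') :
    SmoothConvex L (H + (2 * L) ^ 2) (fun x => softMax (g x) (g' x)) := by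
  have hu : Differentiable ℝ fun x => g x - g' x := h.diff.sub h'.diff
  have eu : fderiv ℝ (fun x => g x - g' x) = fun x => fderiv ℝ g x - fderiv ℝ g' x :=
    funext fun x => fderiv_fun_sub (h.diff x) (h'.diff x)
  have hu' : Differentiable ℝ (fderiv ℝ fun x => g x - g' x) := by
    rw [eu]; exact h.diff_fderiv.sub h'.diff_fderiv
  have hs : Differentiable ℝ fun x => softPos (g x - g' x) := fun x =>
    ((hasDerivAt_softPos _).comp_hasFDerivAt x (hu x).hasFDerivAt).differentiableAt
  have hs' : Differentiable ℝ (fderiv ℝ fun x => softPos (g x - g' x)) := fun x =>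
    (hasFDerivAt_fderiv_softPos_comp hu hu' x).differentiableAt
  have e : fderiv ℝ (fun x => _root_.softMax (g x) (g' x)) =
      fun x => fderiv ℝ g' x + fderiv ℝ (fun x => softPos (g x - g' x)) x :=
    funext fun x => fderiv_fun_add (h'.diff x) (hs x)
  refine ⟨⟨convex_univ, ?_⟩, h'.diff.add hs, ?_, fun x => ?_, fun x v => ?_⟩
  · intro x _ y _ a b ha hb hab
    have hg := h.convex.2 (Set.mem_univ x) (Set.mem_univ y) ha hb hab
    have hg' := h'.convex.2 (Set.mem_univ x) (Set.mem_univ y) ha hb hab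
    refine (softMax_mono hg hg').trans ?_
    have hP := convexOn_softPos.2 (Set.mem_univ (g x - g' x)) (Set.mem_univ (g y - g' y)) ha hb hab
    simp only [smul_eq_mul, _root_.softMax] at hP ⊢
    have : a * g x + b * g y - (a * g' x + b * g' y) = a * (g x - g' x) + b * (g y - g' y) := by
      ring
    rw [this]; linarith
  · rw [e]; exact h'.diff_fderiv.add hs'
  · rw [e, fderiv_softPos_comp hu, eu]
    set p := softPosD (g x - g' x)
    have h0 : 0 ≤ p := softPosD_nonneg _
    have h1 : p ≤ 1 := softPosD_le_one _
    have : fderiv ℝ g' x + p • (fderiv ℝ g x - fderiv ℝ g' x) =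
        (1 - p) • fderiv ℝ g' x + p • fderiv ℝ g x := by module
    simp only
    rw [this]
    refine (norm_add_le _ _).trans ?_
    rw [norm_smul, norm_smul, Real.norm_eq_abs, Real.norm_eq_abs, abs_of_nonneg h0,
      abs_of_nonneg (by linarith : 0 ≤ 1 - p)]
    nlinarith [h.norm_fderiv_le x, h'.norm_fderiv_le x]
  · rw [e, fderiv_fun_add (h'.diff_fderiv x) (hs' x),
      (hasFDerivAt_fderiv_softPos_comp hu hu' x).fderiv, eu,
      fderiv_fun_sub (h.diff_fderiv x) (h'.diff_fderiv x)]
    set p := softPosD (g x - g' x)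
    have h0 : 0 ≤ p := softPosD_nonneg _
    have h1 : p ≤ 1 := softPosD_le_one _
    have h2 := softPosDD_nonneg (g x - g' x)
    have h3 := softPosDD_le_one (g x - g' x)
    have hn : |fderiv ℝ g x v - fderiv ℝ g' x v| ≤ 2 * L * ‖v‖ := by
      have k1 := (fderiv ℝ g x).le_opNorm v
      have k2 := (fderiv ℝ g' x).le_opNorm v
      rw [Real.norm_eq_abs] at k1 k2
      have k3 := mul_le_mul_of_nonneg_right (h.norm_fderiv_le x) (norm_nonneg v)
      have k4 := mul_le_mul_of_nonneg_right (h'.norm_fderiv_le x) (norm_nonneg v)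
      have := abs_sub (fderiv ℝ g x v) (fderiv ℝ g' x v)
      linarith
    have hsq : (fderiv ℝ g x v - fderiv ℝ g' x v) ^ 2 ≤ (2 * L) ^ 2 * ‖v‖ ^ 2 := by
      rw [← sq_abs, ← mul_pow]; exact pow_le_pow_left₀ (abs_nonneg _) hn 2
    have a1 := h.hessian_le x v
    have a2 := h'.hessian_le x v
    simp only [add_apply, smul_apply,
      sub_apply, ContinuousLinearMap.smulRight_apply, smul_eq_mul]
    have b1 := mul_le_mul_of_nonneg_left a1 h0
    have b2 := mul_le_mul_of_nonneg_left a2 (by linarith : 0 ≤ 1 - p)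
    have b3 : softPosDD (g x - g' x) * (fderiv ℝ g x v - fderiv ℝ g' x v) *
        (fderiv ℝ g x v - fderiv ℝ g' x v) ≤ (2 * L) ^ 2 * ‖v‖ ^ 2 := by
      refine le_trans ?_ hsq
      rw [mul_assoc, ← sq]
      exact mul_le_of_le_one_left (sq_nonneg _) h3
    linarith

theorem softPos_affine (ℓ : V →L[ℝ] ℝ) : SmoothConvex ‖ℓ‖ (‖ℓ‖ ^ 2) (fun x => softPos (ℓ x)) := by
  have hu : Differentiable ℝ fun x => ℓ x := ℓ.differentiable
  have eu : fderiv ℝ (fun x => ℓ x) = fun _ => ℓ := funext fun x => ℓ.fderiv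
  have hu' : Differentiable ℝ (fderiv ℝ fun x => ℓ x) := by rw [eu]; exact differentiable_const _
  refine ⟨?_, fun x => ((hasDerivAt_softPos _).comp_hasFDerivAt x
    (hu x).hasFDerivAt).differentiableAt, fun x =>
    (hasFDerivAt_fderiv_softPos_comp hu hu' x).differentiableAt, fun x => ?_, fun x v => ?_⟩
  · exact convexOn_softPos.comp_linearMap ℓ.toLinearMap
  · rw [fderiv_softPos_comp hu, eu]
    simp only [norm_smul, Real.norm_eq_abs, abs_of_nonneg (softPosD_nonneg _)]
    exact mul_le_of_le_one_left (norm_nonneg _) (softPosD_le_one _)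
  · rw [(hasFDerivAt_fderiv_softPos_comp hu hu' x).fderiv, eu]
    simp only [fderiv_fun_const, Pi.zero_apply, smul_zero, zero_add,
      smul_apply, ContinuousLinearMap.smulRight_apply, smul_eq_mul]
    rw [mul_assoc, ← sq, ← mul_pow]
    refine (mul_le_of_le_one_left (sq_nonneg _) (softPosDD_le_one _)).trans ?_
    rw [← sq_abs]
    exact pow_le_pow_left₀ (abs_nonneg _) (ℓ.le_opNorm v) 2

theorem softAbs_affine (ℓ : V →L[ℝ] ℝ) :
    SmoothConvex (2 * ‖ℓ‖) (2 * ‖ℓ‖ ^ 2) (fun x => softAbs (ℓ x)) := by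
  have := (softPos_affine ℓ).add (softPos_affine (-ℓ))
  rw [norm_neg] at this
  simpa [two_mul, softAbs] using this

theorem lipschitzWith (h : SmoothConvex L H g) (hL : L ≤ 1) : LipschitzWith 1 g :=
  lipschitzWith_of_nnnorm_fderiv_le h.diff fun x => by
    rw [← NNReal.coe_le_coe]; exact (h.norm_fderiv_le x).trans (by simpa using hL)

end SmoothConvex

theorem SmoothConvex.mem_convexPotentials {d : ℕ} {L H : ℝ} {g : Eucl d → ℝ}
    (h : SmoothConvex L H g) (hL : L ≤ 1) (hH : H ≤ 1) (reg : Regularity) :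
    g ∈ convexPotentials reg d := by
  refine ⟨h.convex, ?_⟩
  cases reg
  · exact ⟨h.diff, h.diff_fderiv, (h.mono hL hH).hessian_le⟩
  · exact h.lipschitzWith hL

/-! ### Nested cones and the chain of wedges in the plane. -/

/-- The number whose base `B` expansion is truncated after the first `j` digits of `w`. -/
def center (B : ℕ) (w : ℕ → ℕ) (j : ℕ) : ℝ := ∑ i ∈ Finset.range j, (w i : ℝ) / B ^ (i + 1)

/-- The cone of aperture `10 / B ^ j` around the direction `(1, center B w j)`. -/
def InCone (B : ℕ) (w : ℕ → ℕ) (j : ℕ) (s z : ℝ) : Prop :=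
  |z - center B w j * s| < 5 * (1 / (B : ℝ) ^ j) * s

/-- The wedge which penalizes the distance from the direction `(1, center B w j)`. -/
def wedge (B : ℕ) (a : ℝ) (w : ℕ → ℕ) (j : ℕ) (s z : ℝ) : ℝ :=
  softAbs (a / 2 ^ j * (z - center B w j * s)) - 2 * (a / 2 ^ j) * (1 / (B : ℝ) ^ j) * s - 2 * j

/-- The soft maximum of the wedges with indices `j, …, j + k - 1` and of a constant. -/
def wedgeChain (B : ℕ) (a : ℝ) (w : ℕ → ℕ) : ℕ → ℕ → ℝ → ℝ → ℝ
  | 0, j, _, _ => -2 * j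
  | k + 1, j, s, z => softMax (wedge B a w j s z) (wedgeChain B a w k (j + 1) s z)

section chain

variable {B : ℕ} {a : ℝ} {w w' : ℕ → ℕ} {j : ℕ} {s z : ℝ}

theorem center_succ (B : ℕ) (w : ℕ → ℕ) (j : ℕ) :
    center B w (j + 1) = center B w j + w j / B ^ (j + 1) := by
  simp [center, Finset.sum_range_succ]

theorem center_congr (h : ∀ i < j, w i = w' i) : center B w j = center B w' j :=
  Finset.sum_congr rfl fun i hi => by rw [h i (Finset.mem_range.1 hi)]

theorem center_le_center (B : ℕ) (w : ℕ → ℕ) : Monotone (center B w) :=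
  monotone_nat_of_le_succ fun j => by
    rw [center_succ]; linarith [show (0 : ℝ) ≤ w j / B ^ (j + 1) by positivity]

/-- The intervals `[center j, center j + B⁻ʲ]` are nested, because appending a digit selects one of
`B` equal subintervals. -/
theorem center_add_le (hB : 0 < B) (hw : ∀ i, w i < B) (j l : ℕ) :
    center B w (j + l) + 1 / (B : ℝ) ^ (j + l) ≤ center B w j + 1 / (B : ℝ) ^ j := by
  induction l with
  | zero => simp
  | succ l ih =>
    refine le_trans ?_ ih
    rw [← add_assoc, center_succ, add_assoc]
    have hB' : (0 : ℝ) < B := by exact_mod_cast hB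
    have h1 : (w (j + l) : ℝ) + 1 ≤ B := by exact_mod_cast hw (j + l)
    have h2 : (w (j + l) : ℝ) / B ^ (j + l + 1) + 1 / (B : ℝ) ^ (j + l + 1) ≤
        1 / (B : ℝ) ^ (j + l) := by
      rw [← add_div, div_le_div_iff₀ (by positivity) (by positivity), pow_succ]
      nlinarith [pow_pos hB' (j + l)]
    linarith

theorem center_sub_le (hB : 0 < B) (hw : ∀ i, w i < B) {i j : ℕ} (hij : j ≤ i) :
    |center B w i - center B w j| ≤ 1 / (B : ℝ) ^ j := by
  obtain ⟨l, rfl⟩ := Nat.exists_eq_add_of_le hij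
  have := center_add_le hB hw j l
  have h2 : (0 : ℝ) ≤ 1 / (B : ℝ) ^ (j + l) := by positivity
  rw [abs_of_nonneg (sub_nonneg.2 (center_le_center B w hij))]
  linarith

theorem center_nonneg (B : ℕ) (w : ℕ → ℕ) (j : ℕ) : 0 ≤ center B w j :=
  Finset.sum_nonneg fun _ _ => by positivity

theorem center_le_one (hB : 0 < B) (hw : ∀ i, w i < B) (j : ℕ) : center B w j ≤ 1 := by
  have := center_sub_le hB hw (Nat.zero_le j)
  simp [center] at this
  simpa [center] using (abs_le.1 this).2

theorem inCone_congr (h : ∀ i < j, w i = w' i) : InCone B w j s z ↔ InCone B w' j s z := by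
  unfold InCone; rw [center_congr h]

theorem wedge_congr (h : ∀ i < j, w i = w' i) : wedge B a w j s z = wedge B a w' j s z := by
  unfold wedge; rw [center_congr h]

theorem le_wedge (ha : 0 ≤ a) : a / 2 ^ j * |z - center B w j * s| -
    2 * (a / 2 ^ j * (1 / (B : ℝ) ^ j)) * s - 2 * j ≤ wedge B a w j s z := by
  unfold wedge
  have := abs_le_softAbs (a / 2 ^ j * (z - center B w j * s))
  rw [abs_mul, abs_of_nonneg (by positivity : 0 ≤ a / 2 ^ j)] at this
  linarith

theorem wedge_le (ha : 0 ≤ a) : wedge B a w j s z ≤ a / 2 ^ j * |z - center B w j * s| -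
    2 * (a / 2 ^ j * (1 / (B : ℝ) ^ j)) * s - 2 * j + 1 / 3 := by
  unfold wedge
  have := softAbs_le (a / 2 ^ j * (z - center B w j * s))
  rw [abs_mul, abs_of_nonneg (by positivity : 0 ≤ a / 2 ^ j)] at this
  linarith

/-- Put `p = a / 2 ^ j`, `q = B⁻ʲ`, `X = |z - center j * s|`. A later wedge has slope at most `p /
2` and a center within `q`, so for `s ≥ 0` its linear part is at most `p / 2 * (X + q * s)`. This is
at most `p * X - 2 * p * q * s` exactly when `X ≥ 5 * q * s`, which is the origin of the factor 5 in
`InCone`. The offsets `-2 * j` then supply the gap. -/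
theorem wedge_le_wedge_of_not_inCone (hB : 2 ≤ B) (ha : 0 ≤ a) (hw : ∀ i, w i < B)
    (hx : ¬ InCone B w j s z) {i : ℕ} (hij : j < i) :
    wedge B a w i s z ≤ wedge B a w j s z - 2 * (i - j) + 1 / 3 := by
  have h1 := le_wedge (B := B) (w := w) (j := j) (s := s) (z := z) ha
  have h2 := wedge_le (B := B) (w := w) (j := i) (s := s) (z := z) ha
  have hB' : (2 : ℝ) ≤ B := by exact_mod_cast hB
  unfold InCone at hx
  rw [not_lt] at hx
  have hX : |z - center B w i * s| ≤ |z - center B w j * s| + 1 / (B : ℝ) ^ j * |s| := by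
    have e : z - center B w i * s =
        (z - center B w j * s) - (center B w i - center B w j) * s := by ring
    rw [e]
    refine (abs_sub _ _).trans (add_le_add_right ?_ _)
    rw [abs_mul]
    exact mul_le_mul_of_nonneg_right (center_sub_le (by omega) hw hij.le) (abs_nonneg s)
  have hai : a / 2 ^ i ≤ a / 2 ^ j / 2 := by
    rw [div_div, ← pow_succ]
    exact div_le_div_of_nonneg_left ha (by positivity) (pow_le_pow_right₀ (by norm_num) hij)
  have hdi : 1 / (B : ℝ) ^ i ≤ 1 / (B : ℝ) ^ j / 2 := by
    rw [div_div]
    refine div_le_div_of_nonneg_left (by norm_num) (by positivity) ?_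
    calc (B : ℝ) ^ j * 2 ≤ B ^ j * B := by gcongr
      _ = B ^ (j + 1) := (pow_succ _ _).symm
      _ ≤ B ^ i := pow_le_pow_right₀ (by linarith) hij
  have pa : 0 ≤ a / 2 ^ j := by positivity
  have pai : 0 ≤ a / 2 ^ i := by positivity
  have pd : 0 ≤ 1 / (B : ℝ) ^ j := by positivity
  have pdi : 0 ≤ 1 / (B : ℝ) ^ i := by positivity
  generalize a / 2 ^ j = p at *
  generalize a / 2 ^ i = p' at *
  generalize 1 / (B : ℝ) ^ j = q at *
  generalize 1 / (B : ℝ) ^ i = q' at *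
  generalize |z - center B w i * s| = X' at *
  have hX0 := abs_nonneg (z - center B w j * s)
  generalize |z - center B w j * s| = X at *
  have k1 : p' * X' ≤ p / 2 * (X + q * |s|) :=
    (mul_le_mul_of_nonneg_left hX pai).trans (mul_le_mul_of_nonneg_right hai (by positivity))
  rcases le_total s 0 with hs | hs
  · have k2 : p' * q' ≤ p / 2 * (q / 2) := mul_le_mul hai hdi pdi (by positivity)
    have k3 := mul_le_mul_of_nonneg_right k2 (neg_nonneg.2 hs)
    have k4 : 0 ≤ p * X := by positivity
    rw [abs_of_nonpos hs] at k1
    nlinarith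
  · have k2 : 0 ≤ p' * q' * s := by positivity
    have k3 := mul_le_mul_of_nonneg_left hx pa
    rw [abs_of_nonneg hs] at k1
    nlinarith

/-- The smoothing errors do not accumulate: the offset drops by 2 per level, which absorbs the error
of the tail, so only `1/3` from one wedge and `1/6` from one soft maximum remain. -/
theorem wedgeChain_le_of_not_inCone (hB : 2 ≤ B) (ha : 0 ≤ a) (hw : ∀ i, w i < B)
    (hx : ¬ InCone B w j s z) (k : ℕ) {i : ℕ} (hij : j < i) :
    wedgeChain B a w k i s z ≤ wedge B a w j s z - 2 * (i - j) + 1 / 2 := by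
  induction k generalizing i with
  | zero =>
    have h1 := le_wedge (B := B) (w := w) (j := j) (s := s) (z := z) ha
    have h2 : 0 ≤ a / 2 ^ j * |z - center B w j * s| -
        2 * (a / 2 ^ j * (1 / (B : ℝ) ^ j)) * s := by
      unfold InCone at hx
      rw [not_lt] at hx
      have pa : 0 ≤ a / 2 ^ j := by positivity
      have pd : 0 ≤ 1 / (B : ℝ) ^ j := by positivity
      generalize a / 2 ^ j = p at *
      generalize 1 / (B : ℝ) ^ j = q at *
      have hX0 := abs_nonneg (z - center B w j * s)
      generalize |z - center B w j * s| = X at *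
      rcases le_total s 0 with hs | hs
      · have k3 := mul_nonneg (mul_nonneg pa pd) (neg_nonneg.2 hs)
        nlinarith [mul_nonneg pa hX0]
      · have k3 := mul_nonneg (mul_nonneg pa pd) hs
        nlinarith [mul_le_mul_of_nonneg_left hx pa]
    simp only [wedgeChain]
    linarith
  | succ k ih =>
    have h1 := wedge_le_wedge_of_not_inCone hB ha hw hx hij
    have h2 := ih (show j < i + 1 by omega)
    push_cast at h2
    simp only [wedgeChain]
    refine (softMax_le (c := wedge B a w j s z - 2 * (i - j) + 1 / 3) h1 (by linarith)).trans ?_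
    linarith

theorem wedgeChain_eq_wedge_of_not_inCone (hB : 2 ≤ B) (ha : 0 ≤ a) (hw : ∀ i, w i < B)
    (hx : ¬ InCone B w j s z) (k : ℕ) :
    wedgeChain B a w (k + 1) j s z = wedge B a w j s z := by
  have := wedgeChain_le_of_not_inCone hB ha hw hx k (Nat.lt_succ_self j)
  push_cast at this
  exact softMax_of_add_one_le (by linarith)

/-- Outside cone `j` the chain collapses to its wedge `j` from that index on, and the wedges up to
`j` see only the first `j` digits. -/
theorem wedgeChain_congr_of_not_inCone (hB : 2 ≤ B) (ha : 0 ≤ a) (hw : ∀ i, w i < B)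
    (hw' : ∀ i, w' i < B) (h : ∀ i < j, w i = w' i) (hx : ¬ InCone B w j s z) (k l i : ℕ)
    (hil : i + l = j) :
    wedgeChain B a w (l + (k + 1)) i s z = wedgeChain B a w' (l + (k + 1)) i s z := by
  induction l generalizing i with
  | zero =>
    obtain rfl : i = j := by omega
    rw [zero_add, wedgeChain_eq_wedge_of_not_inCone hB ha hw hx,
      wedgeChain_eq_wedge_of_not_inCone hB ha hw' (mt (inCone_congr h).2 hx), wedge_congr h]
  | succ l ih =>
    rw [show l + 1 + (k + 1) = l + (k + 1) + 1 by ring]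
    rw [wedgeChain, wedgeChain, ih (i + 1) (by omega), wedge_congr fun i' hi' => h i' (by omega)]

theorem wedgeChain_le_wedgeChain_add (k l i : ℕ) :
    wedgeChain B a w k (i + l) s z ≤ wedgeChain B a w (l + k) i s z := by
  induction l generalizing i with
  | zero => simp
  | succ l ih =>
    rw [show l + 1 + k = l + k + 1 by ring, show i + (l + 1) = i + 1 + l by ring]
    exact (ih (i + 1)).trans (le_softMax_right _ _)

theorem le_wedgeChain (k i : ℕ) : -2 * ((i : ℝ) + k) ≤ wedgeChain B a w k i s z := by
  have := wedgeChain_le_wedgeChain_add (B := B) (a := a) (w := w) (s := s) (z := z) 0 k i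
  simpa [wedgeChain] using this

/-- Linear growth off the cone, at a rate depending only on `a`, `j` and `B`. It bounds the mass off
the last cone independently of the needle length. -/
theorem wedgeChain_lower_of_not_inCone (hB : 2 ≤ B) (ha : 0 ≤ a) (hw : ∀ i, w i < B)
    (hx : ¬ InCone B w j s z) :
    a / 2 ^ j * (1 / (B : ℝ) ^ j) / 4 * (|s| + |z|) - 2 * j ≤
      wedgeChain B a w (j + 1) 0 s z := by
  have h0 := wedgeChain_le_wedgeChain_add (B := B) (a := a) (w := w) (s := s) (z := z) 1 j 0
  rw [zero_add, wedgeChain_eq_wedge_of_not_inCone hB ha hw hx 0] at h0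
  refine le_trans ?_ h0
  have h1 := le_wedge (B := B) (w := w) (j := j) (s := s) (z := z) ha
  have hB' : (1 : ℝ) ≤ B := by exact_mod_cast (by omega : 1 ≤ B)
  have hz : |z| ≤ |z - center B w j * s| + |s| := by
    have e : z = (z - center B w j * s) + center B w j * s := by ring
    calc |z| ≤ |z - center B w j * s| + |center B w j * s| := by
          conv_lhs => rw [e]
          exact abs_add_le _ _
      _ ≤ _ := by
        refine add_le_add_right ?_ _
        rw [abs_mul, abs_of_nonneg (center_nonneg B w j)]
        exact mul_le_of_le_one_left (abs_nonneg s) (center_le_one (by omega) hw j)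
  unfold InCone at hx
  rw [not_lt] at hx
  have pa : 0 ≤ a / 2 ^ j := by positivity
  have pd : 0 ≤ 1 / (B : ℝ) ^ j := by positivity
  have pd1 : 1 / (B : ℝ) ^ j ≤ 1 := by
    rw [div_le_one (by positivity)]; exact one_le_pow₀ hB'
  generalize a / 2 ^ j = p at *
  generalize 1 / (B : ℝ) ^ j = q at *
  have hX0 := abs_nonneg (z - center B w j * s)
  generalize |z - center B w j * s| = X at *
  have k1 : p * q * |z| ≤ p * q * (X + |s|) := mul_le_mul_of_nonneg_left hz (by positivity)
  have k2 : p * q * X ≤ p * X := by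
    have := mul_le_mul_of_nonneg_left pd1 (mul_nonneg pa hX0)
    linarith
  have k0 : 0 ≤ p * X := by positivity
  rcases le_total s 0 with hs | hs
  · have k3 := mul_nonneg (mul_nonneg pa pd) (neg_nonneg.2 hs)
    rw [abs_of_nonpos hs] at *
    linarith
  · have k3 := mul_nonneg (mul_nonneg pa pd) hs
    have k4 := mul_le_mul_of_nonneg_left hx pa
    rw [abs_of_nonneg hs] at *
    linarith

/-- On the hidden ray the distance to every center is at most `B⁻ⁱ * s`, and the negative term of
the wedge outweighs it. The bound is uniform in `s`, which makes the ray heavy. -/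
theorem wedgeChain_needle_le (hB : 2 ≤ B) (ha : 0 ≤ a) (hw : ∀ i, w i < B) (hs : 0 ≤ s) (m l i : ℕ)
    (hil : i + l = m + 1) : wedgeChain B a w l i s (center B w m * s) ≤ 1 / 2 - 2 * i := by
  induction l generalizing i with
  | zero => simp only [wedgeChain]; linarith
  | succ l ih =>
    have h2 := ih (i + 1) (by omega)
    have h1 := wedge_le (B := B) (w := w) (j := i) (s := s) (z := center B w m * s) ha
    have h3 : |center B w m * s - center B w i * s| ≤ 1 / (B : ℝ) ^ i * s := by
      rw [← sub_mul, abs_mul, abs_of_nonneg hs]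
      exact mul_le_mul_of_nonneg_right (center_sub_le (by omega) hw (by omega)) hs
    have h4 := mul_le_mul_of_nonneg_left h3 (by positivity : 0 ≤ a / 2 ^ i)
    have h5 : 0 ≤ a / 2 ^ i * (1 / (B : ℝ) ^ i) * s := by positivity
    push_cast at h2
    refine (softMax_le (c := 1 / 3 - 2 * i) ?_ ?_).trans ?_ <;> linarith

/-- Changing digit `j` by one shifts the slope by `B ^ -(j + 1)`. In this unit, membership in the
cone says that `c` is within 5 of a fixed real number. -/
theorem card_inCone_update_le (hB : 0 < B) (w : ℕ → ℕ) (j : ℕ) (s z : ℝ) (S : Finset ℕ)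
    (hS : ∀ c ∈ S, InCone B (Function.update w j c) (j + 1) s z) : S.card ≤ 11 := by
  rcases S.eq_empty_or_nonempty with rfl | ⟨c₀, hc₀⟩
  · simp
  have hB' : (0 : ℝ) < B := by exact_mod_cast hB
  have hq : 0 < 1 / (B : ℝ) ^ (j + 1) := by positivity
  -- The cones are empty in the half-plane `s ≤ 0`.
  have hs : 0 < s := by
    have := (abs_nonneg _).trans_lt (hS c₀ hc₀)
    by_contra hneg
    push Not at hneg
    nlinarith [mul_nonneg hq.le (neg_nonneg.2 hneg)]
  set q := 1 / (B : ℝ) ^ (j + 1) with hqdef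
  set u := (z - center B w j * s) / (q * s) with hu
  have key : ∀ c ∈ S, |u - c| < 5 := by
    intro c hc
    have h := hS c hc
    unfold InCone at h
    rw [center_succ, center_congr (w' := w) (fun i hi => Function.update_of_ne hi.ne _ _),
      Function.update_self, ← hqdef] at h
    have e : z - (center B w j + (c : ℝ) / B ^ (j + 1)) * s = (u - c) * (q * s) := by
      rw [hu, hqdef]; field_simp; ring
    rw [e, abs_mul, abs_of_pos (mul_pos hq hs), mul_assoc] at h
    exact lt_of_mul_lt_mul_right h (mul_pos hq hs).le
  have hsub : S.map Nat.castEmbedding ⊆ Finset.Icc ⌈u - 5⌉ ⌊u + 5⌋ := by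
    intro i hi
    obtain ⟨c, hc, rfl⟩ := Finset.mem_map.1 hi
    have := abs_lt.1 (key c hc)
    rw [Finset.mem_Icc, Int.ceil_le, Int.le_floor]
    simp only [Nat.castEmbedding_apply, Int.cast_natCast]
    constructor <;> linarith
  have := Finset.card_le_card hsub
  rw [Finset.card_map, Int.card_Icc] at this
  have h1 := Int.floor_le (u + 5)
  have h2 := Int.le_ceil (u - 5)
  have h3 : ((⌊u + 5⌋ - ⌈u - 5⌉ : ℤ) : ℝ) ≤ (10 : ℤ) := by push_cast; linarith
  have h4 : ⌊u + 5⌋ - ⌈u - 5⌉ ≤ 10 := by exact_mod_cast h3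
  omega

end chain

/-! ### The potential on `ℝ^d` and its regularity. -/

section potential

variable {d : ℕ}

theorem norm_proj_le_one (i : Fin d) : ‖(EuclideanSpace.proj i : Eucl d →L[ℝ] ℝ)‖ ≤ 1 :=
  ContinuousLinearMap.opNorm_le_bound _ zero_le_one fun x => by
    rw [one_mul]; exact PiLp.norm_apply_le x i

theorem SmoothConvex.wedge {B : ℕ} {a : ℝ} {w : ℕ → ℕ} (hB : 0 < B) (ha : 0 ≤ a)
    (hw : ∀ i, w i < B) (j : ℕ) (i₀ i₁ : Fin d) :
    SmoothConvex (6 * a) (8 * a ^ 2) (fun x : Eucl d => wedge B a w j (x i₀) (x i₁)) := by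
  set p : Fin d → (Eucl d →L[ℝ] ℝ) := fun i => EuclideanSpace.proj i with hp
  have hn : ∀ i, ‖p i‖ ≤ 1 := norm_proj_le_one
  set ℓ : Eucl d →L[ℝ] ℝ := (a / 2 ^ j) • (p i₁ - center B w j • p i₀) with hℓ
  set ℓ' : Eucl d →L[ℝ] ℝ := (-(2 * (a / 2 ^ j) * (1 / (B : ℝ) ^ j))) • p i₀ with hℓ'
  have hB' : (1 : ℝ) ≤ B := by exact_mod_cast hB
  have h2 : a / 2 ^ j ≤ a := div_le_self ha (one_le_pow₀ (by norm_num))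
  have h2' : 0 ≤ a / 2 ^ j := by positivity
  have h3 : 1 / (B : ℝ) ^ j ≤ 1 := by
    rw [div_le_one (by positivity)]; exact one_le_pow₀ hB'
  have h3' : 0 ≤ 1 / (B : ℝ) ^ j := by positivity
  have n1 : ‖ℓ‖ ≤ 2 * a := by
    rw [hℓ, norm_smul, Real.norm_eq_abs, abs_of_nonneg h2']
    have : ‖p i₁ - center B w j • p i₀‖ ≤ 2 := by
      refine (norm_sub_le _ _).trans ?_
      rw [norm_smul, Real.norm_eq_abs, abs_of_nonneg (center_nonneg B w j)]
      nlinarith [hn i₁, hn i₀, center_le_one hB hw j, center_nonneg B w j, norm_nonneg (p i₀)]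
    nlinarith [norm_nonneg (p i₁ - center B w j • p i₀)]
  have n2 : ‖ℓ'‖ ≤ 2 * a := by
    rw [hℓ', norm_smul, norm_neg, Real.norm_eq_abs, abs_of_nonneg (by positivity)]
    have k : 2 * (a / 2 ^ j) * (1 / (B : ℝ) ^ j) ≤ 2 * a := by nlinarith
    nlinarith [hn i₀, norm_nonneg (p i₀), mul_nonneg (mul_nonneg zero_le_two h2') h3']
  have := (SmoothConvex.softAbs_affine ℓ).add (SmoothConvex.affine ℓ' (-(2 * j)))
  have e : (fun x : Eucl d => _root_.wedge B a w j (x i₀) (x i₁)) =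
      fun x => softAbs (ℓ x) + (ℓ' x + (-(2 * j))) := by
    funext x
    simp only [_root_.wedge, hℓ, hℓ', hp, smul_apply, sub_apply, PiLp.proj_apply,
      smul_eq_mul]
    ring
  rw [e]
  refine this.mono (by linarith) ?_
  have := pow_le_pow_left₀ (norm_nonneg ℓ) n1 2
  nlinarith

theorem SmoothConvex.wedgeChain {B : ℕ} {a : ℝ} {w : ℕ → ℕ} (hB : 0 < B) (ha : 0 ≤ a)
    (hw : ∀ i, w i < B) (k j : ℕ) (i₀ i₁ : Fin d) :
    SmoothConvex (6 * a) (8 * a ^ 2 + k * (12 * a) ^ 2)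
      (fun x : Eucl d => wedgeChain B a w k j (x i₀) (x i₁)) := by
  induction k generalizing j with
  | zero =>
    have := SmoothConvex.affine (0 : Eucl d →L[ℝ] ℝ) (-2 * j)
    simp only [zero_apply, zero_add, norm_zero] at this
    exact this.mono (by positivity) (by positivity)
  | succ k ih =>
    have h1 := (SmoothConvex.wedge hB ha hw j i₀ i₁).mono le_rfl
      (show 8 * a ^ 2 ≤ 8 * a ^ 2 + k * (12 * a) ^ 2 by
        have : 0 ≤ k * (12 * a) ^ 2 := by positivity
        linarith)
    refine (h1.softMax (ih (j + 1))).mono le_rfl ?_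
    push_cast; nlinarith

/-- The potential whose Gibbs measure concentrates near the ray in direction
`(1, center B w m)` of the coordinate plane `(i₀, i₁)`. -/
def needlePotential (B : ℕ) (a : ℝ) (m : ℕ) (v : Fin d → ℝ) (i₀ i₁ : Fin d) (w : ℕ → ℕ)
    (x : Eucl d) : ℝ :=
  wedgeChain B a w (m + 1) 0 (x i₀) (x i₁) + ∑ i, v i * softAbs (x i)

variable {B : ℕ} {a : ℝ} {m : ℕ} {v : Fin d → ℝ} {i₀ i₁ : Fin d} {w w' : ℕ → ℕ}

theorem SmoothConvex.needlePotential (hB : 0 < B) (ha : 0 ≤ a) (hw : ∀ i, w i < B)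
    (hv : ∀ i, 0 ≤ v i) :
    SmoothConvex (6 * a + ∑ i, 2 * v i) (8 * a ^ 2 + ↑(m + 1) * (12 * a) ^ 2 + ∑ i, 2 * v i)
      (needlePotential B a m v i₀ i₁ w) := by
  refine (SmoothConvex.wedgeChain hB ha hw (m + 1) 0 i₀ i₁).add
    (SmoothConvex.sum Finset.univ fun i _ => ?_)
  have := (SmoothConvex.softAbs_affine (EuclideanSpace.proj i : Eucl d →L[ℝ] ℝ)).const_mul (hv i)
  have h1 := norm_proj_le_one i
  have h2 := pow_le_one₀ (n := 2) (norm_nonneg _) h1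
  refine this.mono ?_ ?_ <;> nlinarith [hv i]

theorem needlePotential_congr (hB : 2 ≤ B) (ha : 0 ≤ a) (hw : ∀ i, w i < B) (hw' : ∀ i, w' i < B)
    {j : ℕ} (hj : j ≤ m) (h : ∀ i < j, w i = w' i) {x : Eucl d}
    (hx : ¬ InCone B w j (x i₀) (x i₁)) :
    needlePotential B a m v i₀ i₁ w x = needlePotential B a m v i₀ i₁ w' x := by
  unfold needlePotential
  have := wedgeChain_congr_of_not_inCone hB ha hw hw' h hx (m - j) j 0 (zero_add j)
  rw [show j + (m - j + 1) = m + 1 by omega] at this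
  rw [this]

end potential

/-! ### Exponential integrals, volumes, warm starts and Gibbs masses. -/

theorem integral_exp_neg_mul_abs {v : ℝ} (hv : 0 < v) :
    ∫ t : ℝ, Real.exp (-(v * |t|)) = 2 / v := by
  rw [integral_comp_abs (f := fun t => Real.exp (-(v * t)))]
  have := integral_exp_mul_Ioi (a := -v) (by linarith) 0
  simp only [neg_mul] at this
  rw [this]; simp; ring

theorem integral_exp_neg_sum_mul_abs {d : ℕ} {v : Fin d → ℝ} (hv : ∀ i, 0 < v i) :
    ∫ x : Eucl d, Real.exp (-∑ i, v i * |x i|) = ∏ i, 2 / v i := by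
  have h := (PiLp.volume_preserving_ofLp (Fin d)).integral_comp
    (MeasurableEquiv.toLp 2 (Fin d → ℝ)).symm.measurableEmbedding
    (fun x : Fin d → ℝ => Real.exp (-∑ i, v i * |x i|))
  rw [h]
  simp_rw [← Finset.sum_neg_distrib, Real.exp_sum]
  rw [integral_fintype_prod_volume_eq_prod (f := fun i t => Real.exp (-(v i * |t|)))]
  exact Finset.prod_congr rfl fun i _ => integral_exp_neg_mul_abs (hv i)

theorem integrable_exp_neg_sum_mul_abs {d : ℕ} {v : Fin d → ℝ} (hv : ∀ i, 0 < v i) :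
    Integrable fun x : Eucl d => Real.exp (-∑ i, v i * |x i|) := by
  by_contra h
  have h1 := integral_exp_neg_sum_mul_abs hv
  -- A non-integrable function has integral 0 by convention, which contradicts the positive product.
  rw [integral_undef h] at h1
  exact (Finset.prod_pos fun i _ => div_pos two_pos (hv i)).ne h1

/-- The ball contains the cube of half-side `r / d`. Half-side `r / √d` would also fit, but the loss
is harmless here. -/
theorem volume_ball_ge {d : ℕ} (hd : 0 < d) (x : Eucl d) {r : ℝ} (hr : 0 < r) :
    ENNReal.ofReal ((2 * r / d) ^ d) ≤ volume (Metric.ball x r) := by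
  have hd' : (0 : ℝ) < d := by exact_mod_cast hd
  have hr' : 0 < r / d := by positivity
  have h1 := Real.volume_pi_ball (x : Fin d → ℝ) hr'
  rw [Fintype.card_fin, ← mul_div_assoc] at h1
  rw [← h1, ← (PiLp.volume_preserving_ofLp (Fin d)).measure_preimage
    measurableSet_ball.nullMeasurableSet]
  refine measure_mono fun y hy => ?_
  rw [Set.mem_preimage, mem_ball_iff_norm, pi_norm_lt_iff hr'] at hy
  rw [mem_ball_iff_norm]
  refine lt_of_pow_lt_pow_left₀ 2 hr.le ?_
  rw [EuclideanSpace.norm_sq_eq]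
  have : Nonempty (Fin d) := ⟨⟨0, hd⟩⟩
  calc ∑ i, ‖(y - x) i‖ ^ 2 < ∑ _i : Fin d, (r / d) ^ 2 :=
        Finset.sum_lt_sum_of_nonempty Finset.univ_nonempty fun i _ =>
          pow_lt_pow_left₀ (hy i) (norm_nonneg _) two_ne_zero
    _ = r ^ 2 / d := by
        rw [Finset.sum_const, Finset.card_univ, Fintype.card_fin, nsmul_eq_mul]; field_simp
    _ ≤ r ^ 2 := div_le_self (sq_nonneg r) (by exact_mod_cast hd)

theorem renyiInf_le {X : Type*} [MeasurableSpace X] {μ ν : Measure X} [IsFiniteMeasure μ]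
    [IsFiniteMeasure ν] {M : ℝ} (h : ∀ s, MeasurableSet s →
      μ s ≤ ENNReal.ofReal (Real.exp M) * ν s) : renyiInf μ ν ≤ M := by
  have hac : μ ≪ ν := Measure.AbsolutelyContinuous.mk fun s hs h0 => by
    have := h s hs
    rw [h0, mul_zero] at this
    exact le_antisymm this zero_le
  rw [renyiInf, if_pos hac]
  have hle : μ.rnDeriv ν ≤ᵐ[ν] fun _ => ENNReal.ofReal (Real.exp M) := by
    refine ae_le_of_forall_setLIntegral_le_of_sigmaFinite (Measure.measurable_rnDeriv μ ν)
      fun s hs _ => ?_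
    rw [setLIntegral_const]
    exact (Measure.setLIntegral_rnDeriv_le s).trans (h s hs)
  calc ENNReal.log (essSup (μ.rnDeriv ν) ν) ≤ ENNReal.log (ENNReal.ofReal (Real.exp M)) :=
        ENNReal.log_monotone (essSup_le_of_ae_le _ hle)
    _ = M := by rw [ENNReal.log_ofReal_of_pos (Real.exp_pos M), Real.log_exp]

/-- The uniform distribution on the unit ball. -/
def uniformBall (d : ℕ) : Measure (Eucl d) :=
  ProbabilityTheory.cond volume (Metric.ball (0 : Eucl d) 1)

instance (d : ℕ) : IsProbabilityMeasure (uniformBall d) :=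
  ProbabilityTheory.cond_isProbabilityMeasure_of_finite
    (Metric.measure_ball_pos volume _ one_pos).ne' measure_ball_lt_top.ne

/-- On the unit ball the relative density is `exp f` times the normalizing constant over the volume
of the ball. -/
theorem renyiInf_uniformBall_gibbs_le {d : ℕ} (hd : 0 < d) {f : Eucl d → ℝ}
    (hf : Integrable fun x => Real.exp (-f x)) {b M : ℝ}
    (hb : ∀ x ∈ Metric.ball (0 : Eucl d) 1, f x ≤ b)
    (hM : Real.exp b * ∫ x, Real.exp (-f x) ≤ Real.exp M * (2 / d) ^ d) :
    renyiInf (uniformBall d) (gibbs f) ≤ M := by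
  have : IsProbabilityMeasure (gibbs f) := isProbabilityMeasure_tilted hf
  refine renyiInf_le fun s hs => ?_
  set Z := ∫ x, Real.exp (-f x) with hZ
  have hZ0 : 0 < Z := integral_exp_pos hf
  have hV : ENNReal.ofReal ((2 / d) ^ d) ≤ volume (Metric.ball (0 : Eucl d) 1) := by
    simpa using volume_ball_ge hd (0 : Eucl d) one_pos
  have hd' : (0 : ℝ) < d := by exact_mod_cast hd
  have hV0 : (0 : ℝ) < (2 / d) ^ d := by positivity
  rw [uniformBall, ProbabilityTheory.cond_apply measurableSet_ball]
  have h1 : volume (Metric.ball (0 : Eucl d) 1 ∩ s) ≤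
      ENNReal.ofReal (Real.exp b * Z) * gibbs f s := by
    rw [gibbs, tilted_apply' _ _ hs, ← lintegral_const_mul' _ _ ENNReal.ofReal_ne_top]
    calc volume (Metric.ball (0 : Eucl d) 1 ∩ s)
        = ∫⁻ _ in Metric.ball (0 : Eucl d) 1 ∩ s, 1 := by simp
      _ ≤ ∫⁻ x in Metric.ball (0 : Eucl d) 1 ∩ s, ENNReal.ofReal (Real.exp b * Z) *
            ENNReal.ofReal (Real.exp (-f x) / Z) := by
          refine setLIntegral_mono' (measurableSet_ball.inter hs) fun x hx => ?_
          rw [← ENNReal.ofReal_mul (by positivity), ← ENNReal.ofReal_one]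
          refine ENNReal.ofReal_le_ofReal ?_
          have : Real.exp b * Z * (Real.exp (-f x) / Z) = Real.exp (b - f x) := by
            rw [sub_eq_add_neg, Real.exp_add]; field_simp
          rw [this]
          exact Real.one_le_exp (by linarith [hb x hx.1])
      _ ≤ _ := lintegral_mono_set Set.inter_subset_right
  have h2 : (volume (Metric.ball (0 : Eucl d) 1))⁻¹ * ENNReal.ofReal (Real.exp b * Z) ≤
      ENNReal.ofReal (Real.exp M) := by
    rw [mul_comm, ← div_eq_mul_inv]
    refine ENNReal.div_le_of_le_mul ?_
    refine le_trans ?_ (mul_le_mul_right hV _)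
    rw [← ENNReal.ofReal_mul (Real.exp_pos M).le]
    exact ENNReal.ofReal_le_ofReal hM
  calc (volume (Metric.ball (0 : Eucl d) 1))⁻¹ * volume (Metric.ball (0 : Eucl d) 1 ∩ s)
      ≤ (volume (Metric.ball (0 : Eucl d) 1))⁻¹ *
        (ENNReal.ofReal (Real.exp b * Z) * gibbs f s) := mul_le_mul_right h1 _
    _ ≤ _ := by rw [← mul_assoc]; exact mul_le_mul_left h2 _

theorem gibbs_real_eq {d : ℕ} (f : Eucl d → ℝ) {s : Set (Eucl d)} (hs : MeasurableSet s) :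
    (gibbs f).real s = (∫ x in s, Real.exp (-f x)) / ∫ x, Real.exp (-f x) := by
  rw [measureReal_def, gibbs, tilted_apply_eq_ofReal_integral' _ hs, ENNReal.toReal_ofReal,
    integral_div]
  exact integral_nonneg fun x => by
    have : 0 ≤ ∫ x, Real.exp (-f x) := integral_nonneg fun _ => (Real.exp_pos _).le
    positivity

theorem half_le_gibbs_real {d : ℕ} {f : Eucl d → ℝ} (hf : Integrable fun x => Real.exp (-f x))
    {s : Set (Eucl d)} (hs : MeasurableSet s)
    (h : ∫ x in sᶜ, Real.exp (-f x) ≤ ∫ x in s, Real.exp (-f x)) : 1 / 2 ≤ (gibbs f).real s := by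
  rw [gibbs_real_eq f hs, le_div_iff₀ (integral_exp_pos hf), ← integral_add_compl hs hf]
  linarith

theorem mul_measureReal_ball_le_setIntegral {d : ℕ} {f : Eucl d → ℝ} (hfc : LipschitzWith 1 f)
    (hf : Integrable fun x => Real.exp (-f x)) {s : Set (Eucl d)} {ι : Type*} (S : Finset ι)
    (p : ι → Eucl d) (hp : ∀ k ∈ S, ∀ l ∈ S, k ≠ l → 1 ≤ dist (p k) (p l)) {b : ℝ}
    (hb : ∀ k ∈ S, f (p k) ≤ b) (hs : ∀ k ∈ S, Metric.ball (p k) (1 / 4) ⊆ s) :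
    S.card * volume.real (Metric.ball (0 : Eucl d) (1 / 4)) * Real.exp (-(b + 1 / 4)) ≤
      ∫ x in s, Real.exp (-f x) := by
  set U := ⋃ k ∈ S, Metric.ball (p k) (1 / 4) with hU
  have hUm : MeasurableSet U := Finset.measurableSet_biUnion _ fun _ _ => measurableSet_ball
  have hvol : volume U = S.card * volume (Metric.ball (0 : Eucl d) (1 / 4)) := by
    rw [hU, measure_biUnion_finset]
    · simp [Measure.addHaar_ball_center]
    · intro k hk l hl hkl
      exact Metric.ball_disjoint_ball (by linarith [hp k hk l hl hkl])
    · exact fun _ _ => measurableSet_ball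
  have hUt : volume U ≠ ⊤ := by
    rw [hvol]; exact ENNReal.mul_ne_top (ENNReal.natCast_ne_top _) measure_ball_lt_top.ne
  calc S.card * volume.real (Metric.ball (0 : Eucl d) (1 / 4)) * Real.exp (-(b + 1 / 4))
      = ∫ _ in U, Real.exp (-(b + 1 / 4)) := by
        simp only [setIntegral_const, smul_eq_mul, measureReal_def, hvol, ENNReal.toReal_mul,
          ENNReal.toReal_natCast]
    _ ≤ ∫ x in U, Real.exp (-f x) := by
        refine setIntegral_mono_on (integrableOn_const hUt) hf.integrableOn hUm fun x hx => ?_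
        simp only [hU, Set.mem_iUnion] at hx
        obtain ⟨k, hk, hx⟩ := hx
        have h1 := hfc.dist_le_mul x (p k)
        rw [Metric.mem_ball] at hx
        rw [Real.dist_eq] at h1
        simp only [NNReal.coe_one, one_mul] at h1
        have := (abs_le.1 h1).2
        exact Real.exp_le_exp.2 (by linarith [hb k hk])
    _ ≤ _ := by
        refine setIntegral_mono_set hf.integrableOn
          (Eventually.of_forall fun x => (Real.exp_pos _).le) ?_
        refine (Set.iUnion₂_subset fun k hk => hs k hk).eventuallyLE

theorem prod_ite_pair_le {d : ℕ} {i₀ i₁ : Fin d} {x y : ℝ} (hx : 1 ≤ x) (hy : 1 ≤ y) :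
    ∏ i, (if i = i₀ ∨ i = i₁ then x else y) ≤ x ^ 2 * y ^ d := by
  rw [Finset.prod_ite, Finset.prod_const, Finset.prod_const]
  refine mul_le_mul (pow_le_pow_right₀ hx ?_) (pow_le_pow_right₀ hy ?_) (by positivity)
    (by positivity)
  · have : (Finset.univ.filter fun i => i = i₀ ∨ i = i₁) ⊆ {i₀, i₁} := by
      intro i; simp
    exact (Finset.card_le_card this).trans Finset.card_le_two
  · exact (Finset.card_filter_le _ _).trans (by simp)

/-! ### Hard instances: regularity, concentration on the last cone, warm start. -/

section needle

variable {d : ℕ} {B K : ℕ} {w : ℕ → ℕ} {i₀ i₁ : Fin d}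

/-- The weights of the coordinates in the separable part of the potentials `needle`. -/
def needleWeight (K : ℕ) (i₀ i₁ i : Fin d) : ℝ :=
  if i = i₀ ∨ i = i₁ then 1 / (K : ℝ) else 1 / (8 * d)

/-- The hard potentials: the Gibbs measure of `needle B K i₀ i₁ w` is concentrated on the cone of
aperture `10 / B ^ d` around the direction with slope `center B w d`. -/
def needle (B K : ℕ) (i₀ i₁ : Fin d) (w : ℕ → ℕ) : Eucl d → ℝ :=
  needlePotential B (1 / (24 * (d + 1))) d (needleWeight K i₀ i₁) i₀ i₁ w

theorem needleWeight_pos (hd : 0 < d) (hK : 8 * d ≤ K) (i : Fin d) :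
    0 < needleWeight K i₀ i₁ i := by
  have : (0 : ℝ) < d := by exact_mod_cast hd
  have : (0 : ℝ) < K := by exact_mod_cast (by omega : 0 < K)
  unfold needleWeight
  split_ifs <;> positivity

theorem sum_needleWeight_le (hd : 0 < d) (hK : 8 * d ≤ K) :
    ∑ i, needleWeight K i₀ i₁ i ≤ 1 / 8 := by
  have h0 : (0 : ℝ) < d := by exact_mod_cast hd
  have h1 : (8 * d : ℝ) ≤ K := by exact_mod_cast hK
  calc ∑ i, needleWeight K i₀ i₁ i ≤ ∑ _i : Fin d, 1 / (8 * (d : ℝ)) := by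
        refine Finset.sum_le_sum fun i _ => ?_
        unfold needleWeight
        split_ifs
        · exact one_div_le_one_div_of_le (by positivity) h1
        · exact le_rfl
    _ = 1 / 8 := by
        rw [Finset.sum_const, Finset.card_univ, Fintype.card_fin, nsmul_eq_mul]; field_simp

/-- The `d + 1` soft maxima add `(d + 1) * (12 * a) ^ 2` to the Hessian bound. The slope `a = 1 /
(24 * (d + 1))` keeps this small, and the weights sum to at most `1/8`. -/
theorem smoothConvex_needle (hd : 0 < d) (hB : 0 < B) (hK : 8 * d ≤ K) (hw : ∀ i, w i < B) :
    SmoothConvex 1 1 (needle B K i₀ i₁ w) := by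
  have h0 : (0 : ℝ) < d := by exact_mod_cast hd
  refine (SmoothConvex.needlePotential (a := 1 / (24 * (d + 1))) (m := d) (i₀ := i₀) (i₁ := i₁) hB
    (by positivity) hw fun i => (needleWeight_pos hd hK i).le).mono ?_ ?_
  all_goals
    have h1 := sum_needleWeight_le (i₀ := i₀) (i₁ := i₁) hd hK
    rw [← Finset.mul_sum]
  · have : 6 * (1 / (24 * ((d : ℝ) + 1))) ≤ 1 / 4 := by
      rw [mul_one_div, div_le_div_iff₀ (by positivity) (by norm_num)]; nlinarith
    linarith
  · have : 8 * (1 / (24 * ((d : ℝ) + 1))) ^ 2 + ↑(d + 1) * (12 * (1 / (24 * ((d : ℝ) + 1)))) ^ 2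
        ≤ 1 / 2 := by
      push_cast
      have e : 8 * (1 / (24 * ((d : ℝ) + 1))) ^ 2 +
          ((d : ℝ) + 1) * (12 * (1 / (24 * ((d : ℝ) + 1)))) ^ 2 =
          (8 + 144 * ((d : ℝ) + 1)) / (576 * ((d : ℝ) + 1) ^ 2) := by
        field_simp
        ring
      rw [e, div_le_div_iff₀ (by positivity) (by norm_num)]
      nlinarith
    linarith

theorem sum_needleWeight_mul_abs_le (hd : 0 < d) (hK : 8 * d ≤ K) (x : Eucl d) :
    ∑ i, needleWeight K i₀ i₁ i * |x i| ≤ ∑ i, needleWeight K i₀ i₁ i * softAbs (x i) :=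
  Finset.sum_le_sum fun i _ =>
    mul_le_mul_of_nonneg_left (abs_le_softAbs _) (needleWeight_pos hd hK i).le

theorem needle_lower (hd : 0 < d) (hK : 8 * d ≤ K) (x : Eucl d) :
    -(2 * (d + 1)) + ∑ i, needleWeight K i₀ i₁ i * |x i| ≤ needle B K i₀ i₁ w x := by
  have h1 := le_wedgeChain (B := B) (a := 1 / (24 * (d + 1))) (w := w) (s := x i₀) (z := x i₁)
    (d + 1) 0
  have h2 := sum_needleWeight_mul_abs_le (i₀ := i₀) (i₁ := i₁) hd hK x
  unfold needle needlePotential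
  push_cast at h1
  linarith

theorem integrable_exp_neg_needle (hd : 0 < d) (hB : 0 < B) (hK : 8 * d ≤ K)
    (hw : ∀ i, w i < B) : Integrable fun x => Real.exp (-needle B K i₀ i₁ w x) := by
  refine Integrable.mono' ((integrable_exp_neg_sum_mul_abs
    (needleWeight_pos (i₀ := i₀) (i₁ := i₁) hd hK)).const_mul (Real.exp (2 * (d + 1))))
    ?_ (Eventually.of_forall fun x => ?_)
  · exact (Real.continuous_exp.comp
      (smoothConvex_needle hd hB hK hw).diff.continuous.neg).aestronglyMeasurable
  · rw [Real.norm_eq_abs, Real.abs_exp, ← Real.exp_add]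
    exact Real.exp_le_exp.2 (by linarith [needle_lower (B := B) (w := w) (i₀ := i₀) (i₁ := i₁) hd hK x])

theorem integral_exp_neg_needle_le (hd : 0 < d) (hB : 0 < B) (hK : 8 * d ≤ K)
    (hw : ∀ i, w i < B) : ∫ x, Real.exp (-needle B K i₀ i₁ w x) ≤
      Real.exp (2 * (d + 1)) * ((2 * K) ^ 2 * (16 * d) ^ d) := by
  have hd1 : (1 : ℝ) ≤ d := by exact_mod_cast hd
  have hK1 : (1 : ℝ) ≤ K := by exact_mod_cast (by omega : 1 ≤ K)
  have hi := integrable_exp_neg_sum_mul_abs (needleWeight_pos (i₀ := i₀) (i₁ := i₁) hd hK)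
  calc ∫ x, Real.exp (-needle B K i₀ i₁ w x)
      ≤ ∫ x : Eucl d, Real.exp (2 * (d + 1)) *
        Real.exp (-∑ i, needleWeight K i₀ i₁ i * |x i|) := by
        refine integral_mono (integrable_exp_neg_needle hd hB hK hw) (hi.const_mul _) fun x => ?_
        simp only [← Real.exp_add]
        exact Real.exp_le_exp.2
          (by linarith [needle_lower (B := B) (w := w) (i₀ := i₀) (i₁ := i₁) hd hK x])
    _ = Real.exp (2 * (d + 1)) * ∏ i, 2 / needleWeight K i₀ i₁ i := by
        rw [integral_const_mul, integral_exp_neg_sum_mul_abs (needleWeight_pos hd hK)]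
    _ ≤ _ := by
        refine mul_le_mul_of_nonneg_left ?_ (Real.exp_pos _).le
        refine le_trans (le_of_eq ?_) (prod_ite_pair_le (i₀ := i₀) (i₁ := i₁)
          (by linarith : (1 : ℝ) ≤ 2 * K) (by linarith : (1 : ℝ) ≤ 16 * d))
        refine Finset.prod_congr rfl fun i _ => ?_
        unfold needleWeight
        split_ifs
        · field_simp
        · field_simp; norm_num

theorem measurableSet_inCone (B : ℕ) (w : ℕ → ℕ) (j : ℕ) (i₀ i₁ : Fin d) :
    MeasurableSet {x : Eucl d | InCone B w j (x i₀) (x i₁)} := by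
  unfold InCone
  refine (isOpen_lt ?_ ?_).measurableSet <;> fun_prop

/-- Off the cone the chain itself confines the two plane coordinates, at rate `β`, so the weak
weights `1 / K` are not needed and `K` is absent from the bound. -/
theorem setIntegral_compl_inCone_le (hd : 0 < d) (hB : 2 ≤ B) (hK : 8 * d ≤ K)
    (hw : ∀ i, w i < B) :
    ∫ x in {x : Eucl d | InCone B w d (x i₀) (x i₁)}ᶜ, Real.exp (-needle B K i₀ i₁ w x) ≤
      Real.exp (2 * d) * ((192 * (d + 1) * 2 ^ d * B ^ d) ^ 2 * (16 * d) ^ d) := by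
  have hd1 : (1 : ℝ) ≤ d := by exact_mod_cast hd
  have hB1 : (1 : ℝ) ≤ B := by exact_mod_cast (by omega : 1 ≤ B)
  set β : ℝ := 1 / (24 * (d + 1)) / 2 ^ d * (1 / (B : ℝ) ^ d) / 4 with hβ
  have hβ0 : 0 < β := by positivity
  set v : Fin d → ℝ := fun i => if i = i₀ ∨ i = i₁ then β else 1 / (8 * d) with hv
  have hv0 : ∀ i, 0 < v i := fun i => by
    simp only [hv]; split_ifs <;> positivity
  have hi := (integrable_exp_neg_sum_mul_abs hv0).const_mul (Real.exp (2 * d))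
  have hlow : ∀ x ∈ {x : Eucl d | InCone B w d (x i₀) (x i₁)}ᶜ,
      Real.exp (-needle B K i₀ i₁ w x) ≤ Real.exp (2 * d) * Real.exp (-∑ i, v i * |x i|) := by
    intro x hx
    rw [← Real.exp_add]
    refine Real.exp_le_exp.2 ?_
    have h1 := wedgeChain_lower_of_not_inCone (a := 1 / (24 * ((d : ℝ) + 1))) hB (by positivity)
      hw hx
    rw [← hβ] at h1
    have h2 := sum_needleWeight_mul_abs_le (i₀ := i₀) (i₁ := i₁) hd hK x
    have h3 : ∑ i, v i * |x i| ≤ ∑ i, ((if i = i₀ then β * |x i| else 0) +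
        (if i = i₁ then β * |x i| else 0) + needleWeight K i₀ i₁ i * |x i|) := by
      refine Finset.sum_le_sum fun i _ => ?_
      have hnn := mul_nonneg (needleWeight_pos (i₀ := i₀) (i₁ := i₁) hd hK i).le (abs_nonneg (x i))
      have hbb := mul_nonneg hβ0.le (abs_nonneg (x i))
      by_cases e : i = i₀ ∨ i = i₁
      · have : v i = β := if_pos e
        rw [this]
        rcases e with e | e
        · rw [if_pos e]; split_ifs <;> linarith
        · rw [if_pos e]; split_ifs <;> linarith
      · have : v i = needleWeight K i₀ i₁ i := by simp only [hv, needleWeight, if_neg e]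
        rw [this]
        split_ifs <;> linarith
    rw [Finset.sum_add_distrib, Finset.sum_add_distrib, Finset.sum_ite_eq' Finset.univ i₀,
      Finset.sum_ite_eq' Finset.univ i₁] at h3
    simp only [Finset.mem_univ, if_true] at h3
    unfold needle needlePotential
    linarith
  calc ∫ x in {x : Eucl d | InCone B w d (x i₀) (x i₁)}ᶜ, Real.exp (-needle B K i₀ i₁ w x)
      ≤ ∫ x in {x : Eucl d | InCone B w d (x i₀) (x i₁)}ᶜ,
          Real.exp (2 * d) * Real.exp (-∑ i, v i * |x i|) :=
        setIntegral_mono_on (integrable_exp_neg_needle hd (by omega) hK hw).integrableOn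
          hi.integrableOn (measurableSet_inCone B w d i₀ i₁).compl hlow
    _ ≤ ∫ x : Eucl d, Real.exp (2 * d) * Real.exp (-∑ i, v i * |x i|) :=
        setIntegral_le_integral hi (Eventually.of_forall fun x => by positivity)
    _ = Real.exp (2 * d) * ∏ i, 2 / v i := by
        rw [integral_const_mul, integral_exp_neg_sum_mul_abs hv0]
    _ ≤ _ := by
        refine mul_le_mul_of_nonneg_left ?_ (Real.exp_pos _).le
        refine le_trans (le_of_eq ?_) (prod_ite_pair_le (i₀ := i₀) (i₁ := i₁)
          (?_ : (1 : ℝ) ≤ 192 * (d + 1) * 2 ^ d * B ^ d) (by linarith : (1 : ℝ) ≤ 16 * d))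
        · refine Finset.prod_congr rfl fun i _ => ?_
          simp only [hv]
          split_ifs
          · rw [hβ]; field_simp; norm_num
          · field_simp; norm_num
        · have p1 : (1 : ℝ) ≤ 2 ^ d := one_le_pow₀ (by norm_num)
          have p2 : (1 : ℝ) ≤ (B : ℝ) ^ d := one_le_pow₀ hB1
          have p3 : (1 : ℝ) ≤ 192 * (d + 1) := by linarith
          nlinarith [mul_le_mul p3 p1 zero_le_one (by linarith),
            mul_le_mul (mul_le_mul p3 p1 zero_le_one (by linarith)) p2 zero_le_one (by positivity)]

/-- The points on the ray along which the Gibbs measure of `needle` is concentrated. -/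
def needlePoint (B : ℕ) (w : ℕ → ℕ) (i₀ i₁ : Fin d) (k : ℕ) : Eucl d :=
  EuclideanSpace.single i₀ (k : ℝ) + EuclideanSpace.single i₁ (center B w d * k)

theorem needlePoint_fst (hi : i₀ ≠ i₁) (k : ℕ) : needlePoint B w i₀ i₁ k i₀ = k := by
  simp [needlePoint, hi]

theorem needlePoint_snd (hi : i₀ ≠ i₁) (k : ℕ) :
    needlePoint B w i₀ i₁ k i₁ = center B w d * k := by
  simp [needlePoint, hi.symm]

/-- The chain contributes at most `1/2`, each of the two plane coordinates at most 2 because `k ≤ 2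
* K`, and the smoothing errors at most `1/24`. -/
theorem needle_needlePoint_le (hd : 0 < d) (hB : 2 ≤ B) (hK : 8 * d ≤ K) (hw : ∀ i, w i < B)
    (hi : i₀ ≠ i₁) {k : ℕ} (hk : k ≤ 2 * K) :
    needle B K i₀ i₁ w (needlePoint B w i₀ i₁ k) ≤ 5 := by
  have hK0 : (0 : ℝ) < K := by exact_mod_cast (by omega : 0 < K)
  have hk' : (k : ℝ) ≤ 2 * K := by exact_mod_cast hk
  have h1 := wedgeChain_needle_le (a := 1 / (24 * ((d : ℝ) + 1))) (w := w) hB (by positivity) hw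
    (Nat.cast_nonneg k) d (d + 1) 0 (by omega)
  have hS := sum_needleWeight_le (i₀ := i₀) (i₁ := i₁) hd hK
  have h2 : ∑ i, needleWeight K i₀ i₁ i * softAbs (needlePoint B w i₀ i₁ k i) ≤
      ∑ i, (needleWeight K i₀ i₁ i * (1 / 3) + ((if i = i₀ then (2 : ℝ) else 0) +
        if i = i₁ then (2 : ℝ) else 0)) := by
    refine Finset.sum_le_sum fun i _ => ?_
    have hv := needleWeight_pos (i₀ := i₀) (i₁ := i₁) hd hK i
    have h3 := mul_le_mul_of_nonneg_left (softAbs_le (needlePoint B w i₀ i₁ k i)) hv.le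
    rw [mul_add] at h3
    have h4 : 1 / (K : ℝ) * k ≤ 2 := by
      rw [one_div_mul_eq_div, div_le_iff₀ hK0]; linarith
    by_cases e0 : i = i₀
    · subst e0
      rw [needlePoint_fst hi, Nat.abs_cast] at h3
      rw [if_pos rfl, if_neg hi, needlePoint_fst hi]
      have : needleWeight K i i₁ i = 1 / K := by simp [needleWeight]
      rw [this] at h3 ⊢
      linarith
    · by_cases e1 : i = i₁
      · subst e1
        rw [needlePoint_snd hi] at h3 ⊢
        rw [if_pos rfl, if_neg hi.symm]
        have : needleWeight K i₀ i i = 1 / K := by simp [needleWeight]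
        rw [this] at h3 ⊢
        have h5 : |center B w d * (k : ℝ)| ≤ k := by
          rw [abs_mul, abs_of_nonneg (center_nonneg B w d), Nat.abs_cast]
          exact mul_le_of_le_one_left (Nat.cast_nonneg k) (center_le_one (by omega) hw d)
        have h6 := mul_le_mul_of_nonneg_left h5 (by positivity : 0 ≤ 1 / (K : ℝ))
        linarith
      · have : needlePoint B w i₀ i₁ k i = 0 := by simp [needlePoint, e0, e1]
        rw [if_neg e0, if_neg e1]
        rw [this] at h3 ⊢
        simp only [abs_zero, mul_zero, zero_add] at h3
        linarith
  rw [Finset.sum_add_distrib, Finset.sum_add_distrib, ← Finset.sum_mul,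
    Finset.sum_ite_eq' Finset.univ i₀, Finset.sum_ite_eq' Finset.univ i₁] at h2
  simp only [Finset.mem_univ, if_true] at h2
  unfold needle needlePotential
  rw [needlePoint_fst hi, needlePoint_snd hi]
  push_cast at h1
  linarith

theorem half_le_gibbs_needle (hd : 0 < d) (hB : 2 ≤ B) (hK : 8 * d ≤ K) (hBK : B ^ d ≤ K)
    (hw : ∀ i, w i < B) (hi : i₀ ≠ i₁)
    (hbig : Real.exp (2 * d + 6) * ((192 * (d + 1) * 2 ^ d * B ^ d) ^ 2 * (16 * d) ^ d) ≤
      K * (1 / (2 * d)) ^ d) :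
    1 / 2 ≤ (gibbs (needle B K i₀ i₁ w)).real {x | InCone B w d (x i₀) (x i₁)} := by
  have hint := integrable_exp_neg_needle (i₀ := i₀) (i₁ := i₁) hd (by omega) hK hw
  refine half_le_gibbs_real hint (measurableSet_inCone B w d i₀ i₁) ?_
  refine (setIntegral_compl_inCone_le hd hB hK hw).trans ?_
  have hB0 : (0 : ℝ) < (B : ℝ) ^ d := by
    have : (0 : ℝ) < B := by exact_mod_cast (by omega : 0 < B)
    positivity
  have key := mul_measureReal_ball_le_setIntegral (s := {x | InCone B w d (x i₀) (x i₁)})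
    ((smoothConvex_needle (i₀ := i₀) (i₁ := i₁) hd (by omega) hK hw).lipschitzWith le_rfl) hint
    -- Starting at `K ≥ B ^ d` makes the cone wide enough to contain balls of radius `1/4`; stopping
    -- at `2 * K` keeps the potential bounded and gives `K` balls.
    (Finset.Ico K (2 * K)) (needlePoint B w i₀ i₁) (b := 5) ?_ ?_ ?_
  · refine le_trans ?_ key
    have hvol : (1 / (2 * d) : ℝ) ^ d ≤ volume.real (Metric.ball (0 : Eucl d) (1 / 4)) := by
      have h := volume_ball_ge hd (0 : Eucl d) (show (0 : ℝ) < 1 / 4 by norm_num)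
      rw [measureReal_def, ← ENNReal.ofReal_le_iff_le_toReal measure_ball_lt_top.ne]
      convert h using 3
      field_simp; norm_num
    rw [Nat.card_Ico, show 2 * K - K = K by omega]
    have e1 : Real.exp (2 * (d : ℝ)) = Real.exp (2 * d + 6) * Real.exp (-6) := by
      rw [← Real.exp_add]; congr 1; ring
    rw [e1]
    calc Real.exp (2 * d + 6) * Real.exp (-6) *
          ((192 * (d + 1) * 2 ^ d * B ^ d) ^ 2 * (16 * d) ^ d)
        = Real.exp (2 * d + 6) * ((192 * (d + 1) * 2 ^ d * B ^ d) ^ 2 * (16 * d) ^ d) *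
          Real.exp (-6) := by ring
      _ ≤ K * (1 / (2 * d)) ^ d * Real.exp (-6) :=
          mul_le_mul_of_nonneg_right hbig (Real.exp_pos _).le
      _ ≤ K * volume.real (Metric.ball (0 : Eucl d) (1 / 4)) * Real.exp (-(5 + 1 / 4)) := by
          gcongr
          norm_num
  · intro k _ l _ hkl
    have h1 : dist (needlePoint B w i₀ i₁ k i₀) (needlePoint B w i₀ i₁ l i₀) ≤
        dist (needlePoint B w i₀ i₁ k) (needlePoint B w i₀ i₁ l) := by
      rw [dist_eq_norm, dist_eq_norm]
      exact PiLp.norm_apply_le (needlePoint B w i₀ i₁ k - needlePoint B w i₀ i₁ l) i₀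
    rw [needlePoint_fst hi, needlePoint_fst hi] at h1
    refine le_trans ?_ h1
    rw [Real.dist_eq]
    have : (1 : ℤ) ≤ |(k : ℤ) - l| := Int.one_le_abs (by omega)
    exact_mod_cast this
  · intro k hk
    exact needle_needlePoint_le hd hB hK hw hi (Finset.mem_Ico.1 hk).2.le
  · intro k hk x hx
    have hkK := (Finset.mem_Ico.1 hk).1
    rw [mem_ball_iff_norm] at hx
    have h0 := (PiLp.norm_apply_le (x - needlePoint B w i₀ i₁ k) i₀).trans_lt hx
    have h1 := (PiLp.norm_apply_le (x - needlePoint B w i₀ i₁ k) i₁).trans_lt hx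
    rw [PiLp.sub_apply, needlePoint_fst hi, Real.norm_eq_abs] at h0
    rw [PiLp.sub_apply, needlePoint_snd hi, Real.norm_eq_abs] at h1
    have hBk : (B : ℝ) ^ d ≤ k := by exact_mod_cast hBK.trans hkK
    have hB1 : (1 : ℝ) ≤ (B : ℝ) ^ d := by
      exact_mod_cast Nat.one_le_pow _ _ (by omega)
    have hc0 := center_nonneg B w d
    have hc1 := center_le_one (B := B) (by omega) hw d
    change |x i₁ - center B w d * x i₀| < 5 * (1 / (B : ℝ) ^ d) * x i₀
    have h2 : |x i₁ - center B w d * x i₀| < 1 / 2 := by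
      have e : x i₁ - center B w d * x i₀ =
          (x i₁ - center B w d * k) - center B w d * (x i₀ - k) := by ring
      rw [e]
      refine (abs_sub _ _).trans_lt ?_
      rw [abs_mul, abs_of_nonneg hc0]
      nlinarith [abs_nonneg (x i₀ - k)]
    refine h2.trans_le ?_
    have h3 : (k : ℝ) - 1 / 4 ≤ x i₀ := by linarith [(abs_lt.1 h0).1]
    have h4 : 3 / 4 ≤ 1 / (B : ℝ) ^ d * x i₀ := by
      rw [one_div_mul_eq_div, le_div_iff₀ hB0]; linarith
    linarith

theorem renyiInf_needle_le (hd : 0 < d) (hB : 2 ≤ B) (hK : 8 * d ≤ K) (hw : ∀ i, w i < B)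
    (hi : i₀ ≠ i₁) {M : ℝ}
    (hM : Real.exp (2 * d + 8) * ((2 * K) ^ 2 * (16 * d) ^ d) ≤ Real.exp M * (2 / d) ^ d) :
    renyiInf (uniformBall d) (gibbs (needle B K i₀ i₁ w)) ≤ M := by
  -- The value at the origin is at most 5, and the Lipschitz bound adds at most 1 on the unit ball.
  refine renyiInf_uniformBall_gibbs_le (b := 6) hd
    (integrable_exp_neg_needle hd (by omega) hK hw) (fun x hx => ?_) ?_
  · have h0 := needle_needlePoint_le (B := B) (K := K) (k := 0) hd hB hK hw hi (Nat.zero_le _)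
    have hz : needlePoint B w i₀ i₁ 0 = 0 := by ext i; simp [needlePoint]
    rw [hz] at h0
    have h1 := ((smoothConvex_needle (i₀ := i₀) (i₁ := i₁) hd (by omega) hK hw).lipschitzWith
      le_rfl).dist_le_mul x 0
    rw [Metric.mem_ball] at hx
    rw [Real.dist_eq] at h1
    simp only [NNReal.coe_one, one_mul] at h1
    linarith [(abs_le.1 h1).2]
  · refine le_trans ?_ hM
    have e : Real.exp (2 * (d : ℝ) + 8) = Real.exp 6 * Real.exp (2 * (d + 1)) := by
      rw [← Real.exp_add]; congr 1; ring
    rw [e, mul_assoc]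
    exact mul_le_mul_of_nonneg_left (integral_exp_neg_needle_le hd (by omega) hK hw)
      (Real.exp_pos _).le

theorem needle_congr (hB : 2 ≤ B) {w' : ℕ → ℕ} (hw : ∀ i, w i < B) (hw' : ∀ i, w' i < B)
    {j : ℕ} (hj : j ≤ d) (h : ∀ i < j, w i = w' i) {x : Eucl d}
    (hx : ¬ InCone B w j (x i₀) (x i₁)) : needle B K i₀ i₁ w x = needle B K i₀ i₁ w' x :=
  needlePotential_congr hB (by positivity) hw hw' hj h hx

end needle

/-! ### Averaging over digits, and runs of an algorithm. -/

/-- Resampling one coordinate of a uniform `w` leaves it uniform, so the mean of each `b p` is at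
most `C / card κ`; some `w` does no worse than the mean of the sum. -/
theorem exists_sum_le_of_sum_update_le {ι κ P : Type*} [Fintype ι] [DecidableEq ι] [Fintype κ]
    [Nonempty κ] (S : Finset P) (idx : P → ι) (b : P → (ι → κ) → ℝ) {C : ℝ}
    (h : ∀ p ∈ S, ∀ w, ∑ c, b p (Function.update w (idx p) c) ≤ C) :
    ∃ w, ∑ p ∈ S, b p w ≤ S.card * C / Fintype.card κ := by
  have hκ : (0 : ℝ) < Fintype.card κ := by exact_mod_cast Fintype.card_pos
  have key : ∀ p ∈ S, ∑ w, b p w ≤ ∑ _w : ι → κ, C / Fintype.card κ := by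
    intro p hp
    -- Exchanging the old and the new value of the coordinate is a bijection, which expresses the
    -- invariance under resampling.
    have hinv : Function.Involutive fun x : (ι → κ) × κ =>
        (Function.update x.1 (idx p) x.2, x.1 (idx p)) := fun x => by
      ext <;> simp
    have e : ∑ x : (ι → κ) × κ, b p (Function.update x.1 (idx p) x.2) =
        ∑ x : (ι → κ) × κ, b p x.1 :=
      Equiv.sum_comp hinv.toPerm fun x => b p x.1
    rw [Fintype.sum_prod_type, Fintype.sum_prod_type] at e
    simp only [Finset.sum_const, Finset.card_univ, nsmul_eq_mul] at e
    rw [← Finset.mul_sum] at e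
    have h1 := Finset.sum_le_sum fun w (_ : w ∈ Finset.univ) => h p hp w
    rw [e] at h1
    rw [← Finset.sum_div, le_div_iff₀ hκ]
    linarith
  have hsum : ∑ w : ι → κ, ∑ p ∈ S, b p w ≤ ∑ _w : ι → κ, S.card * C / Fintype.card κ := by
    rw [Finset.sum_comm]
    refine (Finset.sum_le_sum key).trans (le_of_eq ?_)
    simp only [Finset.sum_const, nsmul_eq_mul]
    ring
  obtain ⟨w, -, hw⟩ := Finset.exists_le_of_sum_le Finset.univ_nonempty hsum
  exact ⟨w, hw⟩

theorem tvDist_ge {X : Type*} [MeasurableSpace X] (μ ν : Measure X) [IsProbabilityMeasure μ]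
    [IsProbabilityMeasure ν] {s : Set X} (hs : MeasurableSet s) :
    ν.real s - μ.real s ≤ tvDist μ ν := by
  have hb : BddAbove (Set.range fun A : {A : Set X // MeasurableSet A} =>
      |μ.real A.1 - ν.real A.1|) := by
    refine ⟨1, ?_⟩
    rintro _ ⟨A, rfl⟩
    have h1 := measureReal_nonneg (μ := μ) (s := A.1)
    have h2 := measureReal_nonneg (μ := ν) (s := A.1)
    have h3 := measureReal_le_one (μ := μ) (s := A.1)
    have h4 := measureReal_le_one (μ := ν) (s := A.1)
    exact abs_le.2 ⟨by linarith, by linarith⟩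
  refine le_trans ?_ (le_ciSup hb ⟨s, hs⟩)
  rw [abs_sub_comm]
  exact le_abs_self _

namespace AdaptiveAlgorithm

variable {d k : ℕ} (A : AdaptiveAlgorithm d k)

/-- The batch of queries in round `i + 1`. -/
def batch (f : Eucl d → ℝ) (r i : ℕ) (x₀ : Eucl d) (ξ : ℕ → unitInterval) : Fin k → Eucl d :=
  A.next r i (ξ i, A.transcript f r x₀ ξ i)

theorem transcript_congr_succ {f f' : Eucl d → ℝ} {r i : ℕ} {x₀ : Eucl d} {ξ : ℕ → unitInterval}
    (h : A.transcript f r x₀ ξ i = A.transcript f' r x₀ ξ i)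
    (hb : ∀ l, f (A.batch f r i x₀ ξ l) = f' (A.batch f r i x₀ ξ l)) :
    A.transcript f r x₀ ξ (i + 1) = A.transcript f' r x₀ ξ (i + 1) := by
  unfold batch at hb
  simp only [transcript]
  rw [← h]
  simp only [hb]

theorem measurable_transcript {f : Eucl d → ℝ} (hf : Measurable f) (r n : ℕ) :
    Measurable fun ω : Eucl d × (ℕ → unitInterval) => A.transcript f r ω.1 ω.2 n := by
  induction n with
  | zero =>
    exact (measurable_fst.prodMk (hf.comp measurable_fst)).prodMk measurable_const
  | succ n ih =>
    have hQ : Measurable fun ω : Eucl d × (ℕ → unitInterval) =>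
        A.next r n (ω.2 n, A.transcript f r ω.1 ω.2 n) :=
      (A.measurable_next r n).comp
        (((measurable_pi_apply n).comp measurable_snd).prodMk ih)
    simp only [transcript]
    refine (measurable_fst.comp ih).prodMk (measurable_pi_iff.2 fun i => ?_)
    refine Fin.lastCases ?_ (fun i => ?_) i
    · simp only [Fin.snoc_last]
      refine measurable_pi_iff.2 fun l => ?_
      have := (measurable_pi_apply l).comp hQ
      exact this.prodMk (hf.comp this)
    · simp only [Fin.snoc_castSucc]
      exact (measurable_pi_apply i).comp (measurable_snd.comp ih)

theorem measurable_batch {f : Eucl d → ℝ} (hf : Measurable f) (r i : ℕ) :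
    Measurable fun ω : Eucl d × (ℕ → unitInterval) => A.batch f r i ω.1 ω.2 :=
  (A.measurable_next r i).comp
    (((measurable_pi_apply i).comp measurable_snd).prodMk (A.measurable_transcript hf r i))

theorem measurable_run {f : Eucl d → ℝ} (hf : Measurable f) (r : ℕ) :
    Measurable fun ω : Eucl d × (ℕ → unitInterval) => A.run f r ω.1 ω.2 :=
  (A.measurable_output r).comp
    (((measurable_pi_apply r).comp measurable_snd).prodMk (A.measurable_transcript hf r r))

end AdaptiveAlgorithm

/-- The first `j` digits of `w`, followed by zeros. -/
def truncDigits (j : ℕ) (w : ℕ → ℕ) (i : ℕ) : ℕ := if i < j then w i else 0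

theorem truncDigits_lt {B j : ℕ} {w : ℕ → ℕ} (hB : 0 < B) (hw : ∀ i, w i < B) (i : ℕ) :
    truncDigits j w i < B := by
  unfold truncDigits; split_ifs
  exacts [hw i, hB]

theorem eq_truncDigits {j : ℕ} (w : ℕ → ℕ) : ∀ i < j, w i = truncDigits j w i := fun i hi => by
  simp [truncDigits, hi]

/-- The digit sequence which extends a finite one by zeros. -/
def extendDigits {d B : ℕ} (w : Fin d → Fin B) (i : ℕ) : ℕ := if h : i < d then w ⟨i, h⟩ else 0

theorem extendDigits_lt {d B : ℕ} (hB : 0 < B) (w : Fin d → Fin B) (i : ℕ) :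
    extendDigits w i < B := by
  unfold extendDigits; split_ifs
  exacts [(w _).2, hB]

theorem extendDigits_update {d B : ℕ} (w : Fin d → Fin B) (j : Fin d) (c : Fin B) :
    extendDigits (Function.update w j c) = Function.update (extendDigits w) j c := by
  ext i
  unfold extendDigits
  by_cases h : i = j
  · subst h; simp
  · rw [Function.update_of_ne h]
    split_ifs with hi
    · rw [Function.update_of_ne (fun h' => h (by rw [← h']))]
    · rfl

theorem truncDigits_update {j n : ℕ} (w : ℕ → ℕ) (c : ℕ) (h : j ≤ n) :
    truncDigits j (Function.update w n c) = truncDigits j w := by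
  ext i
  unfold truncDigits
  split_ifs with hi
  · rw [Function.update_of_ne (by omega)]
  · rfl

/-- The queries `Q` do not depend on `c`, so for each outcome every query lies in at most 11 of the
`B` cones. -/
theorem sum_measure_exists_inCone_le {d k B : ℕ} (hB : 0 < B) {Ω : Type*} [MeasurableSpace Ω]
    (μ : Measure Ω) [IsProbabilityMeasure μ] {Q : Ω → Fin k → Eucl d} (hQ : Measurable Q)
    (w : ℕ → ℕ) (j : ℕ) (i₀ i₁ : Fin d) :
    ∑ c : Fin B, μ.real {ω | ∃ l, InCone B (Function.update w j c) (j + 1) (Q ω l i₀) (Q ω l i₁)} ≤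
      11 * k := by
  classical
  set E : Fin B → Fin k → Set Ω := fun c l =>
    {ω | InCone B (Function.update w j c) (j + 1) (Q ω l i₀) (Q ω l i₁)} with hE
  have hEm : ∀ c l, MeasurableSet (E c l) := fun c l =>
    ((measurable_pi_apply l).comp hQ) (measurableSet_inCone B _ (j + 1) i₀ i₁)
  have h1 : ∀ l, ∑ c, μ (E c l) ≤ 11 := by
    intro l
    calc ∑ c, μ (E c l) = ∫⁻ ω, ∑ c, (E c l).indicator 1 ω ∂μ := by
          rw [lintegral_finsetSum _ fun c _ => measurable_one.indicator (hEm c l)]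
          simp [hEm]
      _ ≤ ∫⁻ _, 11 ∂μ := by
          refine lintegral_mono fun ω => ?_
          simp only [Set.indicator_apply, Pi.one_apply]
          rw [Finset.sum_boole]
          have := card_inCone_update_le hB w j (Q ω l i₀) (Q ω l i₁)
            (((Finset.univ : Finset (Fin B)).filter fun c => ω ∈ E c l).map Fin.valEmbedding) ?_
          · rw [Finset.card_map] at this
            exact_mod_cast this
          · intro c hc
            obtain ⟨c', hc', rfl⟩ := Finset.mem_map.1 hc
            exact (Finset.mem_filter.1 hc').2
      _ = 11 := by simp
  have h1' : ∀ l, ∑ c, μ.real (E c l) ≤ 11 := by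
    intro l
    simp only [measureReal_def]
    rw [← ENNReal.toReal_sum fun c _ => measure_ne_top μ _]
    exact ENNReal.toReal_le_of_le_ofReal (by norm_num) (by simpa using h1 l)
  calc ∑ c : Fin B, μ.real {ω | ∃ l, InCone B (Function.update w j c) (j + 1) (Q ω l i₀) (Q ω l i₁)}
      ≤ ∑ c : Fin B, ∑ l, μ.real (E c l) := by
        refine Finset.sum_le_sum fun c _ => ?_
        have : {ω | ∃ l, InCone B (Function.update w j c) (j + 1) (Q ω l i₀) (Q ω l i₁)} =
            ⋃ l ∈ (Finset.univ : Finset (Fin k)), E c l := by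
          ext; simp [hE]
        rw [this]
        exact measureReal_biUnion_finset_le _ _
    _ = ∑ l, ∑ c, μ.real (E c l) := Finset.sum_comm
    _ ≤ ∑ _l : Fin k, (11 : ℝ) := Finset.sum_le_sum fun l _ => h1' l
    _ = 11 * k := by simp [mul_comm]

/-! ### Indistinguishability of runs and the bound on the rounds. -/

section run

variable {d k B K : ℕ} {i₀ i₁ : Fin d} {w : ℕ → ℕ}

/-- Without luck, `i` rounds reveal at most `i + 1` digits, one of them through the value at the
initial point. The luck is tested on the run with truncated digits, whose batch is independent of
the next digit; by induction that batch is the true one. -/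
theorem transcript_needle_congr (A : AdaptiveAlgorithm d k) (hB : 2 ≤ B) (hw : ∀ i, w i < B)
    {r : ℕ} (hr : r + 2 ≤ d) {x₀ : Eucl d} {ξ : ℕ → unitInterval}
    (h0 : ¬ InCone B w 1 (x₀ i₀) (x₀ i₁))
    (hb : ∀ i < r, ∀ l,
      ¬ InCone B w (i + 2)
        (A.batch (needle B K i₀ i₁ (truncDigits (i + 1) w)) r i x₀ ξ l i₀)
        (A.batch (needle B K i₀ i₁ (truncDigits (i + 1) w)) r i x₀ ξ l i₁))
    {i : ℕ} (hi : i ≤ r) {w' : ℕ → ℕ} (hw' : ∀ i, w' i < B) (hww' : ∀ j < i + 1, w j = w' j) :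
    A.transcript (needle B K i₀ i₁ w) r x₀ ξ i = A.transcript (needle B K i₀ i₁ w') r x₀ ξ i := by
  induction i generalizing w' with
  | zero =>
    simp only [AdaptiveAlgorithm.transcript]
    rw [needle_congr hB hw hw' (by omega) hww' h0]
  | succ i ih =>
    have h1 := ih (by omega) hw' fun j hj => hww' j (by omega)
    have h2 := ih (by omega) (truncDigits_lt (j := i + 1) (by omega) hw) (eq_truncDigits w)
    refine A.transcript_congr_succ h1 fun l => ?_
    refine needle_congr hB hw hw' (j := i + 2) (by omega) hww' ?_
    have := hb i (by omega) l
    unfold AdaptiveAlgorithm.batch at this ⊢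
    rwa [h2]

theorem run_needle_eq (A : AdaptiveAlgorithm d k) (hB : 2 ≤ B) (hw : ∀ i, w i < B)
    {r : ℕ} (hr : r + 2 ≤ d) {x₀ : Eucl d} {ξ : ℕ → unitInterval}
    (h0 : ¬ InCone B w 1 (x₀ i₀) (x₀ i₁))
    (hb : ∀ i < r, ∀ l,
      ¬ InCone B w (i + 2)
        (A.batch (needle B K i₀ i₁ (truncDigits (i + 1) w)) r i x₀ ξ l i₀)
        (A.batch (needle B K i₀ i₁ (truncDigits (i + 1) w)) r i x₀ ξ l i₁)) :
    A.run (needle B K i₀ i₁ w) r x₀ ξ =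
      A.run (needle B K i₀ i₁ (truncDigits (r + 1) w)) r x₀ ξ := by
  unfold AdaptiveAlgorithm.run
  rw [transcript_needle_congr A hB hw hr h0 hb le_rfl
    (truncDigits_lt (j := r + 1) (by omega) hw) (eq_truncDigits w)]

/-- The event that, in the run with `r` rounds on the potential with all later digits erased, the
initial point (`i = 0`), a query of round `i ≤ r`, or the output (`i > r`) lies in a cone which
depends on a digit that has not been seen. -/
def luckyEvent (A : AdaptiveAlgorithm d k) (K : ℕ) (i₀ i₁ : Fin d) (w : Fin d → Fin B) (r : ℕ) :
    ℕ → Set (Eucl d × (ℕ → unitInterval))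
  | 0 => {ω | InCone B (extendDigits w) 1 (ω.1 i₀) (ω.1 i₁)}
  | i + 1 =>
    if i < r then
      {ω | ∃ l, InCone B (extendDigits w) (i + 2)
        (A.batch (needle B K i₀ i₁ (truncDigits (i + 1) (extendDigits w))) r i ω.1 ω.2 l i₀)
        (A.batch (needle B K i₀ i₁ (truncDigits (i + 1) (extendDigits w))) r i ω.1 ω.2 l i₁)}
    else
      {ω | InCone B (extendDigits w) d
        (A.run (needle B K i₀ i₁ (truncDigits (r + 1) (extendDigits w))) r ω.1 ω.2 i₀)
        (A.run (needle B K i₀ i₁ (truncDigits (r + 1) (extendDigits w))) r ω.1 ω.2 i₁)}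

/-- The digit on which `luckyEvent` depends through the cone only. -/
def freshDigit (hd : 0 < d) (r : ℕ) : ℕ → Fin d
  | 0 => ⟨0, hd⟩
  | i + 1 => if h : i < r ∧ i + 1 < d then ⟨i + 1, h.2⟩ else ⟨d - 1, by omega⟩

/-- Truncation erases the fresh digit from the potential, so resampling it moves the cone but not
the query or the output. -/
theorem sum_luckyEvent_update_le (A : AdaptiveAlgorithm d k) (hd : 0 < d) (hB : 0 < B)
    (hK : 8 * d ≤ K) {r : ℕ} (hr : r + 2 ≤ d) (i : ℕ)
    (μ : Measure (Eucl d × (ℕ → unitInterval))) [IsProbabilityMeasure μ] (w : Fin d → Fin B) :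
    ∑ c, μ.real (luckyEvent A K i₀ i₁ (Function.update w (freshDigit hd r i) c) r i) ≤
      11 * (k + 1) := by
  have hf : ∀ j, Measurable (needle B K i₀ i₁ (truncDigits j (extendDigits w))) := fun j =>
    (smoothConvex_needle hd hB hK
      (truncDigits_lt hB (extendDigits_lt hB w))).diff.continuous.measurable
  have h1 : ∀ {Q : Eucl d × (ℕ → unitInterval) → Eucl d}, Measurable Q → ∀ j,
      ∑ c : Fin B, μ.real {ω | InCone B (Function.update (extendDigits w) j c) (j + 1)
        (Q ω i₀) (Q ω i₁)} ≤ 11 * (k + 1) := by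
    intro Q hQ j
    have := sum_measure_exists_inCone_le (k := 1) hB μ (Q := fun ω _ => Q ω)
      (measurable_pi_iff.2 fun _ => hQ) (extendDigits w) j i₀ i₁
    simp only [exists_const, Nat.cast_one, mul_one] at this
    refine this.trans ?_
    have : (0 : ℝ) ≤ k := Nat.cast_nonneg k
    linarith
  cases i with
  | zero =>
    simp only [luckyEvent, freshDigit, extendDigits_update]
    exact h1 measurable_fst 0
  | succ i =>
    by_cases hi : i < r
    · simp only [luckyEvent, freshDigit, extendDigits_update, hi, if_true, true_and,
        show i + 1 < d by omega, dif_pos, truncDigits_update _ _ le_rfl]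
      refine (sum_measure_exists_inCone_le hB μ (A.measurable_batch (hf (i + 1)) r i)
        (extendDigits w) (i + 1) i₀ i₁).trans ?_
      linarith
    · simp only [luckyEvent, freshDigit, extendDigits_update, hi, if_false, false_and, dif_neg,
        not_false_eq_true, truncDigits_update _ _ (show r + 1 ≤ d - 1 by omega)]
      have := h1 (A.measurable_run (hf (r + 1)) r) (d - 1)
      rwa [show d - 1 + 1 = d by omega] at this

theorem exists_outputLaw_le (A : AdaptiveAlgorithm d k) (hd : 2 ≤ d) (hB : 2 ≤ B)
    (hK : 8 * d ≤ K) (ρ₀ : Measure (Eucl d)) [IsProbabilityMeasure ρ₀]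
    (hkB : 88 * (k + 1) * d ^ 2 ≤ B) :
    ∃ w : ℕ → ℕ, (∀ i, w i < B) ∧ ∀ r, r + 2 ≤ d →
      (A.outputLaw (needle B K i₀ i₁ w) ρ₀ r).real {x | InCone B w d (x i₀) (x i₁)} ≤ 1 / 8 := by
  have hB0 : 0 < B := by omega
  have : Nonempty (Fin B) := ⟨⟨0, hB0⟩⟩
  set μ : Measure (Eucl d × (ℕ → unitInterval)) :=
    ρ₀.prod (Measure.infinitePi fun _ : ℕ => (volume : Measure unitInterval)) with hμ
  have : IsProbabilityMeasure μ := by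
    rw [hμ]
    infer_instance
  obtain ⟨w, hw⟩ := exists_sum_le_of_sum_update_le (ι := Fin d) (κ := Fin B)
    -- The algorithm may behave differently for each number `r` of rounds, while one potential must
    -- defeat them all; hence the sum over `r` as well as over the events.
    (Finset.range (d - 1) ×ˢ Finset.range d) (fun p => freshDigit (by omega) p.1 p.2)
    (fun p w => μ.real (luckyEvent A K i₀ i₁ w p.1 p.2)) (C := 11 * (k + 1))
    (fun p hp w => sum_luckyEvent_update_le A (by omega) hB0 hK
      (by have := Finset.mem_range.1 (Finset.mem_product.1 hp).1; omega) p.2 μ w)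
  have hw' : ∑ p ∈ Finset.range (d - 1) ×ˢ Finset.range d,
      μ.real (luckyEvent A K i₀ i₁ w p.1 p.2) ≤ 1 / 8 := by
    refine hw.trans ?_
    rw [Fintype.card_fin, Finset.card_product, Finset.card_range, Finset.card_range,
      div_le_div_iff₀ (by exact_mod_cast hB0) (by norm_num)]
    have h1 : (d - 1) * d ≤ d ^ 2 := by rw [sq]; exact Nat.mul_le_mul_right d (Nat.sub_le d 1)
    have h2 : (((d - 1) * d : ℕ) : ℝ) ≤ ((d ^ 2 : ℕ) : ℝ) := by exact_mod_cast h1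
    have h3 : (88 * (k + 1) * d ^ 2 : ℝ) ≤ B := by exact_mod_cast hkB
    push_cast at h2 ⊢
    have h4 : (0 : ℝ) ≤ 11 * (k + 1) * 8 := by positivity
    nlinarith [mul_le_mul_of_nonneg_right h2 h4]
  refine ⟨extendDigits w, extendDigits_lt hB0 w, fun r hr => ?_⟩
  have hfm : Measurable (needle B K i₀ i₁ (extendDigits w)) :=
    (smoothConvex_needle (by omega) hB0 hK (extendDigits_lt hB0 w)).diff.continuous.measurable
  rw [AdaptiveAlgorithm.outputLaw, map_measureReal_apply (A.measurable_run hfm r)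
    (measurableSet_inCone B _ d i₀ i₁), ← hμ]
  have hsub : (fun ω : Eucl d × (ℕ → unitInterval) =>
      A.run (needle B K i₀ i₁ (extendDigits w)) r ω.1 ω.2) ⁻¹'
        {x | InCone B (extendDigits w) d (x i₀) (x i₁)} ⊆
      ⋃ i ∈ Finset.range d, luckyEvent A K i₀ i₁ w r i := by
    intro ω hω
    by_contra hno
    simp only [Set.mem_iUnion, Finset.mem_range, not_exists] at hno
    have h0 := hno 0 (by omega)
    have hb : ∀ i < r, ∀ l, ¬ InCone B (extendDigits w) (i + 2)
        (A.batch (needle B K i₀ i₁ (truncDigits (i + 1) (extendDigits w))) r i ω.1 ω.2 l i₀)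
        (A.batch (needle B K i₀ i₁ (truncDigits (i + 1) (extendDigits w))) r i ω.1 ω.2 l i₁) := by
      intro i hi l hl
      refine hno (i + 1) (by omega) ?_
      simp only [luckyEvent, if_pos hi]
      exact ⟨l, hl⟩
    have hout := hno (r + 1) (by omega)
    simp only [luckyEvent, lt_irrefl, if_false] at hout
    rw [Set.mem_preimage, run_needle_eq A hB (extendDigits_lt hB0 w) hr h0 hb] at hω
    exact hout hω
  calc μ.real _ ≤ μ.real (⋃ i ∈ Finset.range d, luckyEvent A K i₀ i₁ w r i) :=
        measureReal_mono hsub (measure_ne_top μ _)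
    _ ≤ ∑ i ∈ Finset.range d, μ.real (luckyEvent A K i₀ i₁ w r i) :=
        measureReal_biUnion_finset_le _ _
    _ ≤ ∑ r ∈ Finset.range (d - 1), ∑ i ∈ Finset.range d,
          μ.real (luckyEvent A K i₀ i₁ w r i) :=
        Finset.single_le_sum (f := fun r => ∑ i ∈ Finset.range d,
          μ.real (luckyEvent A K i₀ i₁ w r i))
          (fun _ _ => Finset.sum_nonneg fun _ _ => measureReal_nonneg)
          (Finset.mem_range.2 (by omega))
    _ ≤ 1 / 8 := by rwa [← Finset.sum_product']

/-- The last cone has Gibbs mass at least `1/2` and output mass at most `1/8`, so any accuracy below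
`3/8` is out of reach. -/
theorem le_randomizedComplexity (hd : 2 ≤ d) (hB : 2 ≤ B) (hK : 8 * d ≤ K) (hBK : B ^ d ≤ K)
    (hi : i₀ ≠ i₁)
    (hbig : Real.exp (2 * d + 6) * ((192 * (d + 1) * 2 ^ d * B ^ d) ^ 2 * (16 * d) ^ d) ≤
      K * (1 / (2 * d)) ^ d) (hkB : 88 * (k + 1) * d ^ 2 ≤ B) {ε : ℝ} (hε : ε < 3 / 8)
    (ρ₀ : Measure (Eucl d)) [IsProbabilityMeasure ρ₀] {F : Set (Eucl d → ℝ)}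
    (hF : ∀ w : ℕ → ℕ, (∀ i, w i < B) → needle B K i₀ i₁ w ∈ F) :
    ((d - 1 : ℕ) : ℕ∞) ≤ randomizedComplexity k F ε ρ₀ := by
  refine le_iInf fun A => ?_
  obtain ⟨w, hw, hlaw⟩ := exists_outputLaw_le (i₀ := i₀) (i₁ := i₁) A hd hB hK ρ₀ hkB
  refine le_trans ?_ (le_iSup₂ (f := fun f _ => A.rounds f ρ₀ ε) _ (hF w hw))
  refine le_iInf₂ fun r hr => ?_
  by_contra hlt
  have hr' : r < d - 1 := by
    rw [not_le] at hlt
    exact_mod_cast hlt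
  have hfm : Measurable (needle B K i₀ i₁ w) :=
    (smoothConvex_needle (by omega) (by omega) hK hw).diff.continuous.measurable
  have : IsProbabilityMeasure (A.outputLaw (needle B K i₀ i₁ w) ρ₀ r) :=
    Measure.isProbabilityMeasure_map (A.measurable_run hfm r).aemeasurable
  have : IsProbabilityMeasure (gibbs (needle B K i₀ i₁ w)) :=
    isProbabilityMeasure_tilted (integrable_exp_neg_needle (by omega) (by omega) hK hw)
  have h1 := tvDist_ge (A.outputLaw (needle B K i₀ i₁ w) ρ₀ r) (gibbs (needle B K i₀ i₁ w))
    (measurableSet_inCone B w d i₀ i₁)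
  have h2 := hlaw r (by omega)
  have h3 := half_le_gibbs_needle (i₀ := i₀) (i₁ := i₁) (by omega) hB hK hBK hw hi hbig
  have h4 : tvDist (A.outputLaw (needle B K i₀ i₁ w) ρ₀ r) (gibbs (needle B K i₀ i₁ w)) ≤ ε := hr
  linarith

end run

/-! ### Choice of the parameters `B` and `K`. -/

section parameters

variable {d B : ℕ}

theorem exp_natCast_mul_le (n : ℕ) {x b : ℝ} (hx : x ≤ 8 * n) (hb : 6561 ≤ b) :
    Real.exp x ≤ b ^ n := by
  have h1 : Real.exp 8 ≤ b := by
    have h := Real.exp_one_lt_three.le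
    calc Real.exp 8 = Real.exp 1 ^ 8 := by rw [← Real.exp_nat_mul]; norm_num
      _ ≤ 3 ^ 8 := pow_le_pow_left₀ (Real.exp_pos _).le h 8
      _ ≤ b := by norm_num; exact hb
  calc Real.exp x ≤ Real.exp (n * 8) := Real.exp_le_exp.2 (by linarith)
    _ = Real.exp 8 ^ n := Real.exp_nat_mul _ _
    _ ≤ b ^ n := pow_le_pow_left₀ (Real.exp_pos _).le h1 n

/-- Four factors are each at most `B ^ d`, and the cone width contributes `(B ^ d) ^ 2`; this
accounts for the exponent `6 * d` of `K`. -/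
theorem needle_parameters_mass (hd : 200 ≤ d) (hB : d ^ 4 ≤ B) :
    Real.exp (2 * d + 6) * ((192 * (d + 1) * 2 ^ d * B ^ d) ^ 2 * (16 * d) ^ d) ≤
      ((B ^ (6 * d) : ℕ) : ℝ) * (1 / (2 * d)) ^ d := by
  have hd' : (200 : ℝ) ≤ d := by exact_mod_cast hd
  have hB' : (d : ℝ) ^ 4 ≤ B := by exact_mod_cast hB
  set b := (B : ℝ)
  have hd2 : (40000 : ℝ) ≤ (d : ℝ) ^ 2 := by nlinarith
  have hb : (40000 : ℝ) * d ^ 2 ≤ b := by nlinarith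
  have hb1 : 1 ≤ b := by nlinarith
  have e1 : Real.exp (2 * d + 6) ≤ b ^ d := exp_natCast_mul_le d (by linarith) (by nlinarith)
  have e2 : (192 * ((d : ℝ) + 1)) ^ 2 ≤ b ^ d := by
    refine le_trans ?_ (le_self_pow₀ hb1 (by omega))
    nlinarith
  have e3 : (4 : ℝ) ^ d ≤ b ^ d := pow_le_pow_left₀ (by norm_num) (by nlinarith) d
  have e4 : (16 * d * (2 * d) : ℝ) ^ d ≤ b ^ d :=
    pow_le_pow_left₀ (by positivity) (by nlinarith) d
  have hpos : (0 : ℝ) < (2 * d) ^ d := by positivity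
  rw [one_div, inv_pow, ← div_eq_mul_inv, le_div_iff₀ hpos]
  calc Real.exp (2 * d + 6) * ((192 * (d + 1) * 2 ^ d * b ^ d) ^ 2 * (16 * d) ^ d) * (2 * d) ^ d
      = Real.exp (2 * d + 6) * (192 * ((d : ℝ) + 1)) ^ 2 * 4 ^ d * (16 * d * (2 * d) : ℝ) ^ d *
          (b ^ d) ^ 2 := by
        rw [mul_pow (16 * (d : ℝ)) (2 * d) d, show (4 : ℝ) = 2 ^ 2 by norm_num, ← pow_mul,
          mul_comm 2 d, pow_mul]
        ring
    _ ≤ b ^ d * b ^ d * b ^ d * b ^ d * (b ^ d) ^ 2 := by gcongr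
    _ = ((B ^ (6 * d) : ℕ) : ℝ) := by
        push_cast
        rw [mul_comm 6 d, pow_mul]
        ring

/-- The 15 is 12 from `K ^ 2` plus 3 for factors each at most `B ^ d`. -/
theorem needle_parameters_warm (hd : 200 ≤ d) (hB : d ^ 4 ≤ B) {M : ℝ}
    (hM : 15 * d * Real.log B ≤ M) :
    Real.exp (2 * d + 8) * ((2 * ((B ^ (6 * d) : ℕ) : ℝ)) ^ 2 * (16 * d) ^ d) ≤
      Real.exp M * (2 / d) ^ d := by
  have hd' : (200 : ℝ) ≤ d := by exact_mod_cast hd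
  have hB' : (d : ℝ) ^ 4 ≤ B := by exact_mod_cast hB
  have hM' : (B : ℝ) ^ (15 * d) ≤ Real.exp M := by
    have hB0 : (0 : ℝ) < B := lt_of_lt_of_le (by positivity) hB'
    rw [← Real.log_le_iff_le_exp (by positivity), Real.log_pow]
    push_cast
    exact hM
  push_cast
  set b := (B : ℝ)
  have hd2 : (40000 : ℝ) ≤ (d : ℝ) ^ 2 := by nlinarith
  have hb : (40000 : ℝ) * d ^ 2 ≤ b := by nlinarith
  have hb1 : 1 ≤ b := by nlinarith
  have e1 : Real.exp (2 * d + 8) ≤ b ^ d := exp_natCast_mul_le d (by linarith) (by nlinarith)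
  have e2 : (4 : ℝ) ≤ b ^ d := le_trans (by nlinarith) (le_self_pow₀ hb1 (by omega))
  have e4 : (16 * d * (d / 2) : ℝ) ^ d ≤ b ^ d :=
    pow_le_pow_left₀ (by positivity) (by nlinarith) d
  have hpos : (0 : ℝ) < (d / 2) ^ d := by positivity
  rw [← inv_div, inv_pow, ← div_eq_mul_inv, le_div_iff₀ hpos]
  calc Real.exp (2 * d + 8) * ((2 * b ^ (6 * d)) ^ 2 * (16 * d) ^ d) * (d / 2 : ℝ) ^ d
      = Real.exp (2 * d + 8) * 4 * (16 * d * (d / 2) : ℝ) ^ d * (b ^ d) ^ 12 := by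
        rw [mul_pow (16 * (d : ℝ)) (d / 2) d, mul_comm 6 d, pow_mul]
        ring
    _ ≤ b ^ d * b ^ d * b ^ d * (b ^ d) ^ 12 := by gcongr
    _ = b ^ (15 * d) := by
        rw [mul_comm 15 d, pow_mul]
        ring
    _ ≤ Real.exp M := hM'

end parameters

theorem Polynomial.eval_natCast_le_sum_mul_pow (q : Polynomial ℕ) {d : ℕ} (hd : 1 ≤ d) :
    q.eval d ≤ (∑ i ∈ Finset.range (q.natDegree + 1), q.coeff i) * d ^ q.natDegree := by
  rw [Polynomial.eval_eq_sum_range, Finset.sum_mul]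
  exact Finset.sum_le_sum fun i hi => Nat.mul_le_mul_left _
    (Nat.pow_le_pow_right hd (by simpa [Nat.lt_succ_iff] using hi))

/-- The exponent `Nat.log 2 d` outgrows every degree, so a single `B` serves all polynomials `q`, at
the price of one further logarithm in `M`. -/
theorem Polynomial.eventually_mul_eval_add_one_le_pow_log (q : Polynomial ℕ) :
    ∀ᶠ d : ℕ in atTop, 88 * (q.eval d + 1) * d ^ 2 ≤ d ^ Nat.log 2 d := by
  set S := ∑ i ∈ Finset.range (q.natDegree + 1), q.coeff i with hS
  filter_upwards [eventually_ge_atTop (88 * (S + 1)),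
    eventually_ge_atTop (2 ^ (q.natDegree + 4))] with d h1 h2
  have hd : 1 ≤ d := by omega
  have h3 : q.natDegree + 4 ≤ Nat.log 2 d := Nat.le_log_of_pow_le one_lt_two h2
  have h4 : q.eval d + 1 ≤ (S + 1) * d ^ q.natDegree := by
    have h := q.eval_natCast_le_sum_mul_pow hd
    rw [← hS] at h
    have := Nat.one_le_pow q.natDegree d hd
    rw [add_mul, one_mul]
    exact add_le_add h this
  calc 88 * (q.eval d + 1) * d ^ 2 ≤ 88 * ((S + 1) * d ^ q.natDegree) * d ^ 2 := by gcongr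
    _ = 88 * (S + 1) * d ^ (q.natDegree + 2) := by ring
    _ ≤ d * d ^ (q.natDegree + 2) := by gcongr
    _ = d ^ (q.natDegree + 3) := by ring
    _ ≤ d ^ Nat.log 2 d := Nat.pow_le_pow_right hd (by omega)

theorem log_pow_natLog_le (d : ℕ) :
    15 * d * Real.log ((d ^ Nat.log 2 d : ℕ) : ℝ) ≤ 30 * d * Real.log d ^ 2 := by
  rcases Nat.eq_zero_or_pos d with rfl | hd
  · simp
  have hl : 0 ≤ Real.log d := Real.log_natCast_nonneg d
  have h1 : (Nat.log 2 d : ℝ) * Real.log 2 ≤ Real.log d := by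
    rw [← Real.log_pow]
    refine Real.log_le_log (by positivity) ?_
    exact_mod_cast Nat.pow_log_le_self 2 hd.ne'
  have h2 : (Nat.log 2 d : ℝ) ≤ 2 * Real.log d := by
    have := Real.log_two_gt_d9
    have h0 : (0 : ℝ) ≤ Nat.log 2 d := by positivity
    nlinarith
  push_cast
  rw [Real.log_pow]
  have h3 := mul_le_mul_of_nonneg_right h2 hl
  have h0 : (0 : ℝ) ≤ d := by positivity
  nlinarith [mul_le_mul_of_nonneg_left h3 h0]

theorem ofReal_div_mul_log_le {d : ℕ} {a : ℝ} (hd : 3 ≤ d) (ha : 2 ≤ a) :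
    ENNReal.ofReal ((1 - 0) * (d / (a * Real.log d ^ 3))) ≤ (((d - 1 : ℕ) : ℕ∞) : ℝ≥0∞) := by
  have hd' : (3 : ℝ) ≤ d := by exact_mod_cast hd
  have hl : 1 ≤ Real.log d := by
    rw [Real.le_log_iff_exp_le (by positivity)]
    exact Real.exp_one_lt_three.le.trans hd'
  have h1 : 2 ≤ a * Real.log d ^ 3 := by
    have := one_le_pow₀ hl (n := 3)
    nlinarith
  have h2 : (1 - 0) * (d / (a * Real.log d ^ 3)) ≤ ((d - 1 : ℕ) : ℝ) := by
    rw [Nat.cast_sub (by omega), sub_zero, one_mul, Nat.cast_one]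
    calc d / (a * Real.log d ^ 3) ≤ d / 2 := by gcongr
      _ ≤ d - 1 := by linarith
  calc ENNReal.ofReal _ ≤ ENNReal.ofReal ((d - 1 : ℕ) : ℝ) := ENNReal.ofReal_le_ofReal h2
    _ = _ := by simp

theorem needle_mem_warmPotentials (reg : Regularity) {d B K : ℕ} {i₀ i₁ : Fin d} {w : ℕ → ℕ}
    (hd : 0 < d) (hB : 2 ≤ B) (hK : 8 * d ≤ K) (hw : ∀ i, w i < B) (hi : i₀ ≠ i₁) {M : ℝ}
    (hM : Real.exp (2 * d + 8) * ((2 * K) ^ 2 * (16 * d) ^ d) ≤ Real.exp M * (2 / d) ^ d) :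
    needle B K i₀ i₁ w ∈ warmPotentials reg d (uniformBall d) M :=
  ⟨(smoothConvex_needle hd (by omega) hK hw).mem_convexPotentials le_rfl le_rfl reg,
    integrable_exp_neg_needle hd (by omega) hK hw, renyiInf_needle_le hd hB hK hw hi hM⟩

end

theorem mainTheorem2 (reg : Regularity) :
    ∃ c : ℝ, 0 < c ∧ c < 1 ∧ ∃ (C : ℝ) (m : ℕ),
      ∀ α ε : ℕ → ℝ, Tendsto α atTop atTop → ε =O[atTop] (fun d : ℕ => c ^ d) →
        ∃ (γ : ℕ → ℝ) (ρ₀ : (d : ℕ) → Measure (Eucl d)),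
          γ =O[atTop] (fun d : ℕ => (d : ℝ) ^ (-α d)) ∧
          (∀ d, IsProbabilityMeasure (ρ₀ d)) ∧
          ∀ q : Polynomial ℕ, ∀ᶠ d : ℕ in atTop,
            ENNReal.ofReal ((1 - γ d) * (d / (α d * Real.log d ^ 3))) ≤
              ((randomizedComplexity (q.eval d)
                (warmPotentials reg d (ρ₀ d) (C * d * Real.log d ^ m)) (ε d) (ρ₀ d) : ℕ∞) : ℝ≥0∞)
    := by
  -- Any `c < 1` would do, since only `ε → 0` is needed. The bound holds without loss, so `γ = 0`;
  -- the values 30 and 2 come from `log_pow_natLog_le`.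
  refine ⟨1 / 2, by norm_num, by norm_num, 30, 2, fun α ε hα hε => ⟨fun _ => 0, uniformBall,
    isBigO_zero _ _, fun d => inferInstance, fun q => ?_⟩⟩
  have hε0 : Tendsto ε atTop (nhds 0) :=
    hε.trans_tendsto (tendsto_pow_atTop_nhds_zero_of_lt_one (by norm_num) (by norm_num))
  filter_upwards [hα.eventually_ge_atTop 2, hε0.eventually_lt_const (by norm_num : (0 : ℝ) < 3 / 8),
    q.eventually_mul_eval_add_one_le_pow_log, eventually_ge_atTop 200] with d h2 hεd hq hd
  set B := d ^ Nat.log 2 d with hBdef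
  have hlog : 4 ≤ Nat.log 2 d := Nat.le_log_of_pow_le one_lt_two (by omega)
  have hB4 : d ^ 4 ≤ B := Nat.pow_le_pow_right (by omega) hlog
  have hdB : 8 * d ≤ B := by
    refine le_trans ?_ hB4
    calc 8 * d ≤ d * d := Nat.mul_le_mul_right d (by omega)
      _ = d ^ 2 := by ring
      _ ≤ d ^ 4 := Nat.pow_le_pow_right (by omega) (by omega)
  have hB2 : 2 ≤ B := by omega
  have hBK : B ^ d ≤ B ^ (6 * d) := Nat.pow_le_pow_right (by omega) (by omega)
  have hK : 8 * d ≤ B ^ (6 * d) := hdB.trans (Nat.le_self_pow (by omega) B)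
  have hi : (⟨0, by omega⟩ : Fin d) ≠ ⟨1, by omega⟩ := by simp
  refine (ofReal_div_mul_log_le (by omega) h2).trans ?_
  refine ENat.toENNReal_mono (le_randomizedComplexity (by omega) hB2 hK hBK hi
    (needle_parameters_mass hd hB4) hq hεd (uniformBall d) fun w hw => ?_)
  exact needle_mem_warmPotentials reg (by omega) hB2 hK hw hi
    (needle_parameters_warm hd hB4 (log_pow_natLog_le d))
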